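/- Conventions. Let $n\in\mathbb N$ and let $|G|$ denote Lebesgue measure on $\mathbb{R}^n$. For a nonempty open set $G\subset\mathbb{R}^n$ of finite measure, a rearrangement invariant Banach function norm over $G$ is a functional $\rho$ on the measurable functions $G\to[0,\infty]$, with values $\rho(f)\in[0,\infty]$, such that for all such $f,g,f_k$, all constants $a\ge 0$ and all measurable $E\subset G$: (i) $\rho(f)=0$ iff $f=0$ a.e., $\rho(af)=a\rho(f)$, $\rho(f+g)\le\rho(f)+\rho(g)$; (ii) $f\le g$ a.e. implies $\rho(f)\le\rho(g)$; (iii) $f_k\uparrow f$ a.e. implies $\rho(f_k)\uparrow\rho(f)$; (iv) $\rho(\chi_E)<\infty$; (v) $\int_E f\le C_E\,\rho(f)$ with $C_E<\infty$ independent of $f$; (vi) $\rho(f)=\rho(g)$ whenever $|\{f>\lambda\}|=|\{g>\lambda\}|$ for all $\lambda\ge 0$. Put $f^*(s)=\inf\{\lambda: |\{f>\lambda\}|\le s\}$. A rearrangement invariant Banach function space (r.i. BFS) $X$ is given by r.i. Banach function norms $\|\cdot\|_{X(G)}$ over all nonempty open sets $G\subset\mathbb{R}^n$ of finite measure which are pairwise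 similar: for all such $G,G'$, with $\eta=|G'|/|G|$, one has $\eta\|f\|_{X(G)}=\|g\|_{X(G')}$ whenever $f^*(x)=g^*(\eta x)$ for all $0<x<|G|$. A measurable vector valued function $u$ belongs to $X(G)$ if $\|\,|u|\,\|_{X(G)}<\infty$; $u\in W^1X(G)$ means that $u$ is weakly differentiable in $G$ with $u, Du\in X(G)$; and $u\in W^1X_{\mathrm{loc}}(\Omega)$ means that $u\in W^1X(G)$ for every nonempty open $G$ whose closure is a compact subset of $\Omega$. Theorem. Let $\Omega,\Omega'\subset\mathbb{R}^n$ be open and let $f:\Omega\to\Omega'$ be a bilipschitz homeomorphism, i.e. a homeomorphism of $\Omega$ onto $\Omega'$ such that for some $L>0$, $L^{-1}|x-y|\le|f(x)-f(y)|\le L|x-y|$ for all $x,y\in\Omega$. Let $X$ be an r.i. BFS (no assumption on its Boyd indices is made). If the weak derivative $Df$ belongs to $W^1X_{\mathrm{loc}}(\Omega,\mathbb{R}^{n^2})$, then $f^{-1}$ is weakly differentiable in $\Omega'$ and $Df^{-1}\in W^1X_{\mathrm{loc}}(\Omega',\mathbb{R}^{n^2})$. -/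

import Mathlib

open Set Filter Topology MeasureTheory
open scoped ENNReal NNReal

/-- The Euclidean space `ℝⁿ`. -/
abbrev RSpace (n : ℕ) : Type := EuclideanSpace ℝ (Fin n)

/-- A Banach function norm `ρ` over a measure space, defined on the nonnegative
(almost everywhere) measurable functions with values in `[0, ∞]`. The values of `ρ` at other
functions are irrelevant. -/
structure IsBanachFunctionNorm {α : Type*} [MeasurableSpace α] (μ : Measure α)
    (ρ : (α → ℝ≥0∞) → ℝ≥0∞) : Prop where
  eq_zero_iff : ∀ f : α → ℝ≥0∞, AEMeasurable f μ → (ρ f = 0 ↔ f =ᵐ[μ] 0)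
  smul : ∀ (a : ℝ≥0) (f : α → ℝ≥0∞), AEMeasurable f μ →
    ρ (fun x => (a : ℝ≥0∞) * f x) = (a : ℝ≥0∞) * ρ f
  add_le : ∀ f g : α → ℝ≥0∞, AEMeasurable f μ → AEMeasurable g μ →
    ρ (fun x => f x + g x) ≤ ρ f + ρ g
  mono : ∀ f g : α → ℝ≥0∞, AEMeasurable f μ → AEMeasurable g μ →
    f ≤ᵐ[μ] g → ρ f ≤ ρ g
  fatou : ∀ (f : ℕ → α → ℝ≥0∞) (g : α → ℝ≥0∞), (∀ k, AEMeasurable (f k) μ) → AEMeasurable g μ →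
    (∀ᵐ x ∂μ, Monotone fun k => f k x) →
    (∀ᵐ x ∂μ, Tendsto (fun k => f k x) atTop (𝓝 (g x))) →
    Tendsto (fun k => ρ (f k)) atTop (𝓝 (ρ g))
  indicator_lt_top : ∀ s : Set α, MeasurableSet s → μ s < ⊤ →
    ρ (s.indicator fun _ => 1) < ⊤
  lintegral_le : ∀ s : Set α, MeasurableSet s → μ s < ⊤ →
    ∃ C : ℝ≥0, ∀ f : α → ℝ≥0∞, AEMeasurable f μ → ∫⁻ x in s, f x ∂μ ≤ (C : ℝ≥0∞) * ρ f

/-- A rearrangement invariant Banach function norm: equimeasurable functions (functions with the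
same distribution function) have the same norm. -/
structure IsRIBanachFunctionNorm {α : Type*} [MeasurableSpace α] (μ : Measure α)
    (ρ : (α → ℝ≥0∞) → ℝ≥0∞) : Prop extends IsBanachFunctionNorm μ ρ where
  rearrangement_invariant : ∀ f g : α → ℝ≥0∞, AEMeasurable f μ → AEMeasurable g μ →
    (∀ c : ℝ≥0, μ {x | (c : ℝ≥0∞) < f x} = μ {x | (c : ℝ≥0∞) < g x}) → ρ f = ρ g

/-- The non-increasing rearrangement
`f*(s) = inf {c : μ {f > c} ≤ s}` of a nonnegative function `f`. -/
noncomputable def rearrangement {α : Type*} [MeasurableSpace α] (μ : Measure α)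
    (f : α → ℝ≥0∞) (s : ℝ) : ℝ≥0∞ :=
  sInf {c : ℝ≥0∞ | μ {x | c < f x} ≤ ENNReal.ofReal s}

/-- The dilation operator `E_s` on functions on `(0, a)`:
`E_s h (x) = h (s x)` if `s x < a`, and `0` otherwise. -/
noncomputable def dilation (a s : ℝ) (h : ℝ → ℝ≥0∞) (x : ℝ) : ℝ≥0∞ :=
  if s * x < a then h (s * x) else 0

/-- Function norms `ρ` over `G` and `ρ'` over `G'` (sets of positive finite measure) are similar
if, with `η = |G'| / |G|`, one has `η ρ(f) = ρ'(g)` whenever `E_η (g*) = f*` on `(0, |G|)`. -/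
def SimilarNorms {n : ℕ} (G G' : Set (RSpace n))
    (ρ ρ' : (RSpace n → ℝ≥0∞) → ℝ≥0∞) : Prop :=
  ∀ f g : RSpace n → ℝ≥0∞,
    AEMeasurable f (volume.restrict G) → AEMeasurable g (volume.restrict G') →
    (∀ x ∈ Ioo (0 : ℝ) (volume.real G),
      dilation (volume.real G') (volume.real G' / volume.real G)
        (rearrangement (volume.restrict G') g) x = rearrangement (volume.restrict G) f x) →
    (volume G' / volume G) * ρ f = ρ' g

/-- The domains on which the function spaces live: nonempty open sets of finite measure. -/
structure IsFiniteDomain {n : ℕ} (G : Set (RSpace n)) : Prop where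
  isOpen : IsOpen G
  nonempty : G.Nonempty
  volume_lt_top : volume G < ⊤

/-- A rearrangement invariant Banach function space `X` on `ℝⁿ`: for each nonempty open set `G` of
finite measure an r.i. Banach function norm `X.norm G` over `G`, such that any two
of them are similar. The values of `norm` at other sets are irrelevant. -/
structure RIBanachFunctionSpace (n : ℕ) where
  norm : Set (RSpace n) → (RSpace n → ℝ≥0∞) → ℝ≥0∞
  isRI : ∀ G, IsFiniteDomain G → IsRIBanachFunctionNorm (volume.restrict G) (norm G)
  similar : ∀ G G', IsFiniteDomain G → IsFiniteDomain G' →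
    SimilarNorms G G' (norm G) (norm G')

/-- `u ∈ X(G)` for a vector valued function `u`: it is measurable on `G` and `‖ |u| ‖_{X(G)} < ∞`. -/
def RIBanachFunctionSpace.Mem {n : ℕ} (X : RIBanachFunctionSpace n) {F : Type*}
    [NormedAddCommGroup F] (G : Set (RSpace n)) (u : RSpace n → F) : Prop :=
  AEStronglyMeasurable u (volume.restrict G) ∧ X.norm G (fun x => ‖u x‖ₑ) < ⊤

/-- `v` is the weak derivative of `u` in the open set `G`: both are locally integrable in `G` and
`∫_G (∂_w φ) u = - ∫_G φ (v w)` for all test functions `φ ∈ C_c^∞(G)` and all directions `w`. -/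
structure HasWeakDerivOn {n : ℕ} {F : Type*} [NormedAddCommGroup F] [NormedSpace ℝ F]
    (G : Set (RSpace n)) (u : RSpace n → F) (v : RSpace n → RSpace n →L[ℝ] F) : Prop where
  locallyIntegrableOn : LocallyIntegrableOn u G volume
  locallyIntegrableOn_deriv : LocallyIntegrableOn v G volume
  integral_eq : ∀ φ : RSpace n → ℝ, ContDiff ℝ (⊤ : ℕ∞) φ → HasCompactSupport φ → tsupport φ ⊆ G →
    ∀ w : RSpace n, ∫ x in G, (fderiv ℝ φ x w) • u x = - ∫ x in G, φ x • v x w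

/-- `u ∈ W¹X(G)`: `u` is weakly differentiable in `G`, and `u` and `Du` belong to `X(G)`. -/
def MemW1 {n : ℕ} (X : RIBanachFunctionSpace n) {F : Type*} [NormedAddCommGroup F]
    [NormedSpace ℝ F] (G : Set (RSpace n)) (u : RSpace n → F) : Prop :=
  ∃ v : RSpace n → RSpace n →L[ℝ] F, HasWeakDerivOn G u v ∧ X.Mem G u ∧ X.Mem G v

/-- `u ∈ W¹X_loc(Ω)`: `u ∈ W¹X(G)` for all (nonempty) open `G` whose closure is a compact
subset of `Ω`. -/
def MemW1Loc {n : ℕ} (X : RIBanachFunctionSpace n) {F : Type*} [NormedAddCommGroup F]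
    [NormedSpace ℝ F] (Ω : Set (RSpace n)) (u : RSpace n → F) : Prop :=
  ∀ G : Set (RSpace n), IsOpen G → G.Nonempty → IsCompact (closure G) → closure G ⊆ Ω →
    MemW1 X G u

/-- `f` is bilipschitz on `Ω`. -/
def IsBilipschitzOn {n : ℕ} (f : RSpace n → RSpace n) (Ω : Set (RSpace n)) : Prop :=
  ∃ L : ℝ, 0 < L ∧ ∀ x ∈ Ω, ∀ y ∈ Ω,
    L⁻¹ * ‖x - y‖ ≤ ‖f x - f y‖ ∧ ‖f x - f y‖ ≤ L * ‖x - y‖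

/-! ### Weak derivatives: localisation, uniqueness and Lipschitz functions. -/

section WeakDerivatives

variable {n : ℕ} {F : Type*} [NormedAddCommGroup F] [NormedSpace ℝ F]

/-! Write `g` for the inverse of `f`. It is Lipschitz, hence weakly differentiable with its
classical derivative, and differentiating `f ∘ g = id` gives `Dg = (Df ∘ g)⁻¹` almost everywhere.
Both matrices have norm at most `L`, and on the compact set of such matrices inversion coincides
with a compactly supported `C¹` map `Φ` (`exists_contDiff_hasCompactSupport_eq_inverse`). So `Dg = Φ
∘ Df ∘ g`, and a weak chain rule (`HasWeakDerivOn.comp_contDiff_comp_lipschitz`) yields `D(Dg) =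
DΦ(Df ∘ g) · (D²f ∘ g) · Dg`, which is bounded by a constant times `|D²f ∘ g|`. The chain rule is
proved by mollification with `L¹` convergence of the derivatives on compact sets; density of smooth
functions in `X` plays no role.

It remains to see that `D²f ∘ g` lies in `X`. Since `f` is Lipschitz, pushing Lebesgue measure
forward by `g` increases it by at most the factor `Lⁿ`, so the distribution function of `|D²f ∘ g|`
is at most `Lⁿ` times that of `|D²f|`. Such a factor is harmless in every r.i. space
(`RIBanachFunctionSpace.norm_lt_top_of_measure_le`): Lebesgue measure has no atoms, so a simple
function splits into two pieces with half its distribution function. After `p` halvings the triangle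
inequality costs `2 ^ p`, and each piece is compared with `|D²f|` through similarity and
monotonicity of the norms. Boyd indices never enter. -/

theorem MeasureTheory.LocallyIntegrableOn.integrable_smul_of_tsupport_subset
    {Ω : Set (RSpace n)} {h : RSpace n → F} (hh : LocallyIntegrableOn h Ω volume)
    {φ : RSpace n → ℝ} (hφ : Continuous φ) (hc : HasCompactSupport φ) (hs : tsupport φ ⊆ Ω) :
    Integrable (fun x => φ x • h x) volume := by
  have h1 : IntegrableOn h (tsupport φ) volume := hh.integrableOn_compact_subset hs hc
  have h2 : IntegrableOn (fun x => φ x • h x) (tsupport φ) volume :=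
    h1.continuousOn_smul hφ.continuousOn hc
  rwa [integrableOn_iff_integrable_of_support_subset] at h2
  intro x hx
  apply subset_tsupport
  intro h0
  exact hx (by simp [h0])

theorem setIntegral_smul_eq_integral_of_tsupport_subset {Ω : Set (RSpace n)}
    {φ : RSpace n → ℝ} (hs : tsupport φ ⊆ Ω) (h : RSpace n → F) :
    ∫ x in Ω, φ x • h x = ∫ x, φ x • h x := by
  apply setIntegral_eq_integral_of_forall_compl_eq_zero
  intro x hx
  rw [image_eq_zero_of_notMem_tsupport (fun h => hx (hs h)), zero_smul]

theorem HasWeakDerivOn.congr {Ω : Set (RSpace n)}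
    {u u' : RSpace n → F} {v v' : RSpace n → RSpace n →L[ℝ] F} (h : HasWeakDerivOn Ω u v)
    (hu : u =ᵐ[volume.restrict Ω] u') (hv : v =ᵐ[volume.restrict Ω] v') :
    HasWeakDerivOn Ω u' v' where
  locallyIntegrableOn := h.1.congr hu
  locallyIntegrableOn_deriv := h.2.congr hv
  integral_eq φ h1 h2 h3 w := by
    have e1 : ∫ x in Ω, (fderiv ℝ φ x w) • u' x = ∫ x in Ω, (fderiv ℝ φ x w) • u x := by
      apply integral_congr_ae
      filter_upwards [hu] with x hx
      rw [hx]
    have e2 : ∫ x in Ω, φ x • v' x w = ∫ x in Ω, φ x • v x w := by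
      apply integral_congr_ae
      filter_upwards [hv] with x hx
      rw [hx]
    rw [e1, e2, h.integral_eq φ h1 h2 h3 w]

theorem MeasureTheory.LocallyIntegrableOn.clm_apply {Ω : Set (RSpace n)}
    {v : RSpace n → RSpace n →L[ℝ] F} (hv : LocallyIntegrableOn v Ω volume) (w : RSpace n) :
    LocallyIntegrableOn (fun x => v x w) Ω volume := by
  intro x hx
  obtain ⟨s, hs, hi⟩ := hv x hx
  exact ⟨s, hs, (ContinuousLinearMap.apply ℝ F w).integrable_comp hi⟩

/-- The fundamental lemma of the calculus of variations, applied to each basis direction. It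
identifies a given weak derivative of a Lipschitz map with the classical one. -/
theorem HasWeakDerivOn.ae_eq [CompleteSpace F] {Ω : Set (RSpace n)} (hΩ : IsOpen Ω)
    {u : RSpace n → F} {v v' : RSpace n → RSpace n →L[ℝ] F} (h : HasWeakDerivOn Ω u v)
    (h' : HasWeakDerivOn Ω u v') : v =ᵐ[volume.restrict Ω] v' := by
  have key : ∀ i : Fin n, ∀ᵐ x, x ∈ Ω →
      v x (EuclideanSpace.basisFun (Fin n) ℝ i) - v' x (EuclideanSpace.basisFun (Fin n) ℝ i) = 0 := by
    intro i
    set w := EuclideanSpace.basisFun (Fin n) ℝ i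
    apply hΩ.ae_eq_zero_of_integral_contDiff_smul_eq_zero
    · exact (h.2.clm_apply w).sub (h'.2.clm_apply w)
    · intro g hg hc hs
      have e1 := h.integral_eq g hg hc hs w
      have e2 := h'.integral_eq g hg hc hs w
      rw [e1, neg_inj, setIntegral_smul_eq_integral_of_tsupport_subset hs,
        setIntegral_smul_eq_integral_of_tsupport_subset hs] at e2
      simp_rw [smul_sub]
      rw [integral_sub, e2, sub_self]
      · exact (h.2.clm_apply w).integrable_smul_of_tsupport_subset hg.continuous hc hs
      · exact (h'.2.clm_apply w).integrable_smul_of_tsupport_subset hg.continuous hc hs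
  rw [EventuallyEq, ae_restrict_iff' hΩ.measurableSet]
  filter_upwards [ae_all_iff.2 key] with x hx hxΩ
  have : (v x : RSpace n →ₗ[ℝ] F) = v' x := by
    apply (EuclideanSpace.basisFun (Fin n) ℝ).toBasis.ext
    intro i
    simpa using sub_eq_zero.1 (hx i hxΩ)
  exact ContinuousLinearMap.coe_injective this

theorem LipschitzWith.integral_fderiv_smul_eq [FiniteDimensional ℝ F] {C : ℝ≥0}
    {u : RSpace n → F} (hu : LipschitzWith C u) {φ : RSpace n → ℝ}
    (hφ : ContDiff ℝ (⊤ : ℕ∞) φ) (hc : HasCompactSupport φ) (w : RSpace n) :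
    ∫ x, (fderiv ℝ φ x w) • u x = - ∫ x, φ x • fderiv ℝ u x w := by
  have : CompleteSpace F := FiniteDimensional.complete ℝ F
  have hmeas : LocallyIntegrableOn (fderiv ℝ u) univ volume := by
    borelize F
    rw [locallyIntegrableOn_univ]
    refine (memLp_top_of_bound (measurable_fderiv ℝ u).aestronglyMeasurable C
      (Eventually.of_forall fun x => ?_)).locallyIntegrable le_top
    exact norm_fderiv_le_of_lipschitz ℝ hu
  have hu' : LocallyIntegrableOn u univ volume := by
    rw [locallyIntegrableOn_univ]
    exact hu.continuous.locallyIntegrable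
  have i2 := (hmeas.clm_apply w).integrable_smul_of_tsupport_subset hφ.continuous hc
    (subset_univ _)
  have i1 := hu'.integrable_smul_of_tsupport_subset (φ := fun x => fderiv ℝ φ x w)
    ((hφ.continuous_fderiv (by simp)).clm_apply continuous_const)
    (hc.fderiv_apply ℝ w) (subset_univ _)
  -- Testing with continuous functionals reduces the claim to integration by parts for real valued
  -- Lipschitz functions.
  rw [SeparatingDual.eq_iff_forall_dual_eq (R := ℝ)]
  intro l
  rw [map_neg, ← l.integral_comp_comm i1, ← l.integral_comp_comm i2]
  obtain ⟨D, hD⟩ := hφ.lipschitzWith_of_hasCompactSupport hc (by simp)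
  have hl : LipschitzWith (‖l‖₊ * C) (fun x => l (u x)) := l.lipschitz.comp hu
  have key := hl.integral_lineDeriv_mul_eq (μ := volume) hD hc w
  have e1 : ∫ x, l (φ x • fderiv ℝ u x w) = ∫ x, lineDeriv ℝ (fun x => l (u x)) x w * φ x := by
    apply integral_congr_ae
    filter_upwards [hu.ae_differentiableAt (μ := volume)] with x hx
    have hd : HasFDerivAt (fun x => l (u x)) (l.comp (fderiv ℝ u x)) x :=
      l.hasFDerivAt.comp x hx.hasFDerivAt
    rw [(hd.hasLineDerivAt w).lineDeriv]
    simp [mul_comm]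
  have e2 : ∫ x, l (fderiv ℝ φ x w • u x) = - ∫ x, lineDeriv ℝ φ x (-w) * l (u x) := by
    rw [← integral_neg]
    congr 1
    ext x
    have hd := (hφ.differentiable (by simp)) x
    rw [hd.lineDeriv_eq_fderiv]
    simp
  rw [e1, e2, key]

/-- A Lipschitz function is weakly differentiable, and its weak derivative is the classical one. -/
theorem LipschitzOnWith.hasWeakDerivOn [FiniteDimensional ℝ F] {C : ℝ≥0} {Ω : Set (RSpace n)}
    (hΩ : IsOpen Ω) {u : RSpace n → F} (hu : LipschitzOnWith C u Ω) :
    HasWeakDerivOn Ω u (fderiv ℝ u) := by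
  have : CompleteSpace F := FiniteDimensional.complete ℝ F
  obtain ⟨u', hu', heq⟩ := hu.extend_finite_dimension
  suffices H : HasWeakDerivOn Ω u' (fderiv ℝ u') by
    apply H.congr
    · filter_upwards [ae_restrict_mem hΩ.measurableSet] with x hx using (heq hx).symm
    · filter_upwards [ae_restrict_mem hΩ.measurableSet] with x hx
      exact (heq.eventuallyEq_of_mem (hΩ.mem_nhds hx)).symm.fderiv_eq
  refine ⟨hu'.continuous.locallyIntegrable.locallyIntegrableOn _, ?_, ?_⟩
  · borelize F
    refine LocallyIntegrable.locallyIntegrableOn ?_ _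
    refine (memLp_top_of_bound (measurable_fderiv ℝ u').aestronglyMeasurable
      (lipschitzExtensionConstant F * C : ℝ≥0) (Eventually.of_forall fun x => ?_)).locallyIntegrable
      le_top
    exact norm_fderiv_le_of_lipschitz ℝ hu'
  · intro φ hφ hc hs w
    rw [setIntegral_smul_eq_integral_of_tsupport_subset hs,
      setIntegral_smul_eq_integral_of_tsupport_subset
        ((tsupport_fderiv_apply_subset ℝ w).trans hs)]
    exact hu'.integral_fderiv_smul_eq hφ hc w

/-! ### Mollification of weakly differentiable functions. -/

theorem MeasureTheory.LocallyIntegrableOn.integrable_indicator_isCompact {H : Type*} [NormedAddCommGroup H]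
    {Ω T : Set (RSpace n)} {v : RSpace n → H} (h : LocallyIntegrableOn v Ω volume)
    (hT : IsCompact T) (hTΩ : T ⊆ Ω) : Integrable (T.indicator v) volume :=
  (h.integrableOn_compact_subset hTΩ hT).integrable_indicator hT.isClosed.measurableSet

open scoped Convolution in
theorem integral_norm_normed_convolution_le [CompleteSpace F] (η : ContDiffBump (0 : RSpace n))
    {h : RSpace n → F} (hh : Integrable h volume) :
    ∫ x, ‖(η.normed volume ⋆[ContinuousLinearMap.lsmul ℝ ℝ, volume] h) x‖ ≤ ∫ x, ‖h x‖ := by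
  have h1 : ∫ x, (η.normed volume ⋆[ContinuousLinearMap.lsmul ℝ ℝ, volume] fun x => ‖h x‖) x
      = ∫ x, ‖h x‖ := by
    rw [integral_convolution _ η.integrable_normed hh.norm, η.integral_normed]
    simp
  rw [← h1]
  apply integral_mono
  · exact (η.integrable_normed.integrable_convolution _ hh).norm
  · exact η.integrable_normed.integrable_convolution _ hh.norm
  · intro x
    refine (norm_integral_le_integral_norm _).trans (le_of_eq ?_)
    congr 1
    ext t
    simp [norm_smul, abs_of_nonneg (η.nonneg_normed t)]

open scoped Convolution in
-- Almost everywhere convergence together with the `L¹` contraction property forces `L¹`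
-- convergence: `‖c k‖ + ‖h‖ - ‖c k - h‖` lies between `0` and `2‖h‖`, so dominated convergence
-- applies to it although `c k` itself has no dominating function at hand.
theorem tendsto_integral_norm_normed_convolution_sub [CompleteSpace F]
    {η : ℕ → ContDiffBump (0 : RSpace n)} {K : ℝ}
    (h0 : Tendsto (fun k => (η k).rOut) atTop (𝓝 0)) (hK : ∀ k, (η k).rOut ≤ K * (η k).rIn)
    {h : RSpace n → F} (hh : Integrable h volume) :
    Tendsto (fun k => ∫ x, ‖((η k).normed volume ⋆[ContinuousLinearMap.lsmul ℝ ℝ, volume] h) x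
      - h x‖) atTop (𝓝 0) := by
  set c := fun k => ((η k).normed volume ⋆[ContinuousLinearMap.lsmul ℝ ℝ, volume] h) with hc
  have hci : ∀ k, Integrable (c k) volume := fun k =>
    (η k).integrable_normed.integrable_convolution _ hh
  have hd : Tendsto (fun k => ∫ x, (‖c k x‖ + ‖h x‖ - ‖c k x - h x‖)) atTop
      (𝓝 (∫ x, (‖h x‖ + ‖h x‖))) := by
    apply tendsto_integral_of_dominated_convergence (fun x => ‖h x‖ + ‖h x‖)
    · intro k
      exact (((hci k).norm.add hh.norm).sub ((hci k).sub hh).norm).aestronglyMeasurable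
    · exact hh.norm.add hh.norm
    · intro k
      refine Eventually.of_forall fun x => ?_
      rw [Real.norm_eq_abs, abs_le]
      have t1 := norm_sub_le (c k x) (h x)
      have t2 := norm_sub_norm_le (c k x) (h x)
      have := norm_nonneg (h x)
      constructor <;> linarith
    · filter_upwards [ContDiffBump.ae_convolution_tendsto_right_of_locallyIntegrable h0
        (Eventually.of_forall hK) hh.locallyIntegrable] with x hx
      have := (hx.norm.add_const ‖h x‖).sub (hx.sub_const (h x)).norm
      simpa using this
  have hb : ∀ k, ∫ x, ‖c k x - h x‖ ≤ (∫ x, (‖h x‖ + ‖h x‖)) -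
      ∫ x, (‖c k x‖ + ‖h x‖ - ‖c k x - h x‖) := by
    intro k
    rw [integral_sub (f := fun x => ‖c k x‖ + ‖h x‖) ((hci k).norm.add hh.norm)
      (g := fun x => ‖c k x - h x‖) ((hci k).sub hh).norm, integral_add hh.norm hh.norm, integral_add (hci k).norm hh.norm]
    have := integral_norm_normed_convolution_le (η k) hh
    simp only [hc] at *
    linarith
  refine squeeze_zero (fun k => integral_nonneg fun x => norm_nonneg _) hb ?_
  simpa using hd.const_sub (∫ x, (‖h x‖ + ‖h x‖))

open scoped Convolution in
-- The derivative falls on the kernel, and the reflected kernel centred at `x` is an admissible test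
-- function. As its support stays inside `T`, cutting `u` and `v` off outside `T` changes nothing at
-- `x`.
theorem HasWeakDerivOn.fderiv_normed_convolution [CompleteSpace F]
    {Ω T : Set (RSpace n)} {u : RSpace n → F} {v : RSpace n → RSpace n →L[ℝ] F}
    (h : HasWeakDerivOn Ω u v) (hT : IsCompact T) (hTΩ : T ⊆ Ω)
    (η : ContDiffBump (0 : RSpace n)) {x : RSpace n} (hx : Metric.closedBall x η.rOut ⊆ T) :
    fderiv ℝ (η.normed volume ⋆[ContinuousLinearMap.lsmul ℝ ℝ, volume] T.indicator u) x =
      (η.normed volume ⋆[ContinuousLinearMap.lsmul ℝ ℝ, volume] T.indicator v) x := by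
  have hTm : MeasurableSet T := hT.isClosed.measurableSet
  have iu : Integrable (T.indicator u) volume :=
    h.1.integrable_indicator_isCompact hT hTΩ
  have iv : Integrable (T.indicator v) volume :=
    h.2.integrable_indicator_isCompact hT hTΩ
  have hd := (η.hasCompactSupport_normed (μ := volume)).hasFDerivAt_convolution_left
    (ContinuousLinearMap.lsmul ℝ ℝ) (η.contDiff_normed (n := 1)) iu.locallyIntegrable x
  rw [hd.fderiv]
  ext1 w
  set ψ : RSpace n → ℝ := fun t => η.normed volume (x - t) with hψ
  have hψs : ContDiff ℝ (⊤ : ℕ∞) ψ := η.contDiff_normed.comp (contDiff_const.sub contDiff_id)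
  have hψt : tsupport ψ ⊆ Metric.closedBall x η.rOut := by
    apply closure_minimal _ Metric.isClosed_closedBall
    intro t ht
    have : x - t ∈ Function.support (η.normed volume) := ht
    rw [η.support_normed_eq, mem_ball_zero_iff] at this
    rw [mem_closedBall_iff_norm']
    exact this.le
  have hψc : HasCompactSupport ψ :=
    (isCompact_closedBall x η.rOut).of_isClosed_subset (isClosed_tsupport _) hψt
  have hψd : ∀ t, fderiv ℝ ψ t w = - fderiv ℝ (η.normed volume) (x - t) w := by
    intro t
    have h1 : HasFDerivAt (η.normed volume) (fderiv ℝ (η.normed volume) (x - t)) (x - t) :=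
      ((η.contDiff_normed (n := 1)).differentiable (by simp) _).hasFDerivAt
    have h2 : HasFDerivAt (fun t : RSpace n => x - t) (-ContinuousLinearMap.id ℝ (RSpace n)) t :=
      (hasFDerivAt_id t).const_sub x
    have h3 : HasFDerivAt ψ _ t := h1.comp t h2
    rw [h3.fderiv]
    simp
  have key := h.integral_eq ψ hψs hψc (hψt.trans (hx.trans hTΩ)) w
  rw [setIntegral_smul_eq_integral_of_tsupport_subset (hψt.trans (hx.trans hTΩ)),
    setIntegral_smul_eq_integral_of_tsupport_subset
        ((tsupport_fderiv_apply_subset ℝ w).trans (hψt.trans (hx.trans hTΩ)))] at key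
  have hout : ∀ t, t ∉ T → ψ t = 0 := fun t ht =>
    image_eq_zero_of_notMem_tsupport (fun h' => ht (hx (hψt h')))
  have hout' : ∀ t, t ∉ T → fderiv ℝ ψ t w = 0 := fun t ht =>
    image_eq_zero_of_notMem_tsupport (f := fun t => fderiv ℝ ψ t w)
      (fun h' => ht (hx (hψt (tsupport_fderiv_apply_subset ℝ w h'))))
  have e1 : ((fderiv ℝ (η.normed volume) ⋆[ContinuousLinearMap.precompL (RSpace n)
      (ContinuousLinearMap.lsmul ℝ ℝ), volume] T.indicator u) x) w =
      - ∫ t, fderiv ℝ ψ t w • u t := by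
    rw [convolution_eq_swap, ContinuousLinearMap.integral_apply, ← integral_neg]
    · congr 1
      ext1 t
      by_cases ht : t ∈ T
      · simp [ContinuousLinearMap.precompL_apply, hψd, ht]
      · have := hout' t ht
        rw [hψd, neg_eq_zero] at this
        simp [hψd, ht, this]
    · have := ((η.hasCompactSupport_normed (μ := volume)).fderiv ℝ).convolutionExists_left
        (ContinuousLinearMap.precompL (RSpace n) (ContinuousLinearMap.lsmul ℝ ℝ : ℝ →L[ℝ] F →L[ℝ] F))
        ((η.contDiff_normed (n := 1)).continuous_fderiv (by simp)) iu.locallyIntegrable x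
      exact this.integrable_swap
  have e2 : ((η.normed volume ⋆[ContinuousLinearMap.lsmul ℝ ℝ, volume] T.indicator v) x) w =
      ∫ t, ψ t • v t w := by
    rw [convolution_eq_swap, ContinuousLinearMap.integral_apply]
    · congr 1
      ext1 t
      by_cases ht : t ∈ T
      · simp [hψ, ht]
      · have := hout t ht
        simp [this, ht]
    · have := (η.hasCompactSupport_normed (μ := volume)).convolutionExists_left
        (ContinuousLinearMap.lsmul ℝ ℝ : ℝ →L[ℝ] (RSpace n →L[ℝ] F) →L[ℝ] (RSpace n →L[ℝ] F))
        (η.contDiff_normed (n := 1)).continuous iv.locallyIntegrable x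
      exact this.integrable_swap
  rw [e1, e2, key, neg_neg]

open scoped Convolution in
/-- Smooth approximation of a weakly differentiable function, near a compact set. -/
theorem HasWeakDerivOn.exists_contDiff_tendsto [CompleteSpace F]
    {Ω S : Set (RSpace n)} (hΩ : IsOpen Ω) {u : RSpace n → F} {v : RSpace n → RSpace n →L[ℝ] F}
    (h : HasWeakDerivOn Ω u v) (hS : IsCompact S) (hSΩ : S ⊆ Ω) :
    ∃ a : ℕ → RSpace n → F, (∀ k, ContDiff ℝ 1 (a k)) ∧ (∀ k, HasCompactSupport (a k)) ∧
      (∀ᵐ x, x ∈ S → Tendsto (fun k => a k x) atTop (𝓝 (u x))) ∧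
      Tendsto (fun k => ∫ x in S, ‖fderiv ℝ (a k) x - v x‖) atTop (𝓝 0) := by
  obtain ⟨δ, hδ, hsub⟩ := hS.exists_cthickening_subset_open hΩ hSΩ
  set T := Metric.cthickening δ S with hTdef
  have hT : IsCompact T := hS.cthickening
  have hTm : MeasurableSet T := hT.isClosed.measurableSet
  have iu : Integrable (T.indicator u) volume :=
    h.1.integrable_indicator_isCompact hT hsub
  have iv : Integrable (T.indicator v) volume :=
    h.2.integrable_indicator_isCompact hT hsub
  have hST : S ⊆ T := Metric.self_subset_cthickening S
  -- Radii at most `δ` keep the balls around points of `S` inside `T`; the fixed ratio `2` of outer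
  -- to inner radius is what the almost everywhere convergence requires.
  set η : ℕ → ContDiffBump (0 : RSpace n) := fun k =>
    ⟨δ / (k + 1) / 2, δ / (k + 1), by positivity, by apply half_lt_self; positivity⟩ with hη
  have hr : Tendsto (fun k => (η k).rOut) atTop (𝓝 0) := by
    have := tendsto_one_div_add_atTop_nhds_zero_nat (𝕜 := ℝ)
    simpa [hη, div_eq_mul_inv] using this.const_mul δ
  have hrδ : ∀ k, (η k).rOut ≤ δ := by
    intro k
    apply div_le_self hδ.le
    have : (0 : ℝ) ≤ k := Nat.cast_nonneg k
    linarith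
  have hK : ∀ k, (η k).rOut ≤ 2 * (η k).rIn := by
    intro k
    simp only [hη]
    linarith
  refine ⟨fun k => (η k).normed volume ⋆[ContinuousLinearMap.lsmul ℝ ℝ, volume] T.indicator u,
    fun k => ?_, fun k => ?_, ?_, ?_⟩
  · exact ((η k).hasCompactSupport_normed).contDiff_convolution_left (n := 1) _
      (η k).contDiff_normed iu.locallyIntegrable
  · refine ((η k).hasCompactSupport_normed).convolution _ ?_
    exact HasCompactSupport.intro hT fun x hx => indicator_of_notMem hx _
  · filter_upwards [ContDiffBump.ae_convolution_tendsto_right_of_locallyIntegrable hr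
        (Eventually.of_forall hK) iu.locallyIntegrable] with x hx hxS
    simpa [hST hxS] using hx
  · have := tendsto_integral_norm_normed_convolution_sub hr hK iv
    refine squeeze_zero (fun k => integral_nonneg fun x => norm_nonneg _) (fun k => ?_) this
    have e : ∫ x in S, ‖fderiv ℝ ((η k).normed volume ⋆[ContinuousLinearMap.lsmul ℝ ℝ, volume]
        T.indicator u) x - v x‖ = ∫ x in S, ‖((η k).normed volume
          ⋆[ContinuousLinearMap.lsmul ℝ ℝ, volume] T.indicator v) x - T.indicator v x‖ := by
      apply setIntegral_congr_fun hS.isClosed.measurableSet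
      intro x hx
      have hb : Metric.closedBall x (η k).rOut ⊆ T :=
        (Metric.closedBall_subset_closedBall (hrδ k)).trans
          (Metric.closedBall_subset_cthickening hx δ)
      simp only [h.fderiv_normed_convolution hT hsub (η k) hb, indicator_of_mem (hST hx)]
    rw [e]
    exact setIntegral_le_integral
      (((η k).integrable_normed.integrable_convolution _ iv).sub iv).norm
      (Eventually.of_forall fun x => norm_nonneg _)

/-! ### Change of variables as a pushforward bound, and the weak chain rule. -/

/-- Localises the pushforward bound to compact sets, where weak derivatives are integrable. This
bound replaces a Jacobian formula throughout: it pulls back null sets and controls integrals of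
compositions. -/
theorem map_restrict_le_of_mapsTo {g : RSpace n → RSpace n} (hg : Measurable g)
    {Ω Ω' S S' : Set (RSpace n)} {c : ℝ≥0}
    (hmap : Measure.map g (volume.restrict Ω') ≤ c • volume.restrict Ω)
    (hΩ' : S' ⊆ Ω') (hS : MeasurableSet S)
    (hm : MapsTo g S' S) :
    Measure.map g (volume.restrict S') ≤ c • volume.restrict S := by
  refine Measure.le_iff.2 fun s hs => ?_
  have h1 := Measure.le_iff'.1 hmap (s ∩ S)
  rw [Measure.map_apply hg (hs.inter hS), Measure.restrict_apply (hg (hs.inter hS)),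
    Measure.smul_apply, Measure.restrict_apply (hs.inter hS)] at h1
  rw [Measure.map_apply hg hs, Measure.restrict_apply (hg hs), Measure.smul_apply,
    Measure.restrict_apply hs]
  refine le_trans (measure_mono ?_) (h1.trans ?_)
  · rintro y ⟨hy, hy'⟩
    exact ⟨⟨hy, hm hy'⟩, hΩ' hy'⟩
  · exact mul_le_mul' (le_refl (c : ℝ≥0∞)) (measure_mono inter_subset_left)

theorem quasiMeasurePreserving_of_map_le_smul {α β : Type*} [MeasurableSpace α]
    [MeasurableSpace β] {μ : Measure α} {ν : Measure β} {g : α → β} (hg : Measurable g) {c : ℝ≥0}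
    (hmap : Measure.map g μ ≤ c • ν) : Measure.QuasiMeasurePreserving g μ ν :=
  ⟨hg, Measure.absolutelyContinuous_of_le_smul (c := (c : ℝ≥0∞)) hmap⟩

theorem integrable_comp_of_map_le_smul {α β F : Type*} [MeasurableSpace α]
    [MeasurableSpace β] [NormedAddCommGroup F] {μ : Measure α} {ν : Measure β} {g : α → β}
    (hg : Measurable g) {c : ℝ≥0} (hmap : Measure.map g μ ≤ c • ν) {h : β → F} (hh : Integrable h ν) :
    Integrable (fun y => h (g y)) μ :=
  ((hh.smul_measure (c := (c : ℝ≥0∞)) ENNReal.coe_ne_top).mono_measure hmap).comp_measurable hg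

theorem integral_norm_comp_le_of_map_le_smul {α β F : Type*} [MeasurableSpace α]
    [MeasurableSpace β] [NormedAddCommGroup F] {μ : Measure α} {ν : Measure β} {g : α → β}
    (hg : Measurable g) {c : ℝ≥0} (hmap : Measure.map g μ ≤ c • ν) {h : β → F} (hh : Integrable h ν) :
    ∫ y, ‖h (g y)‖ ∂μ ≤ c * ∫ x, ‖h x‖ ∂ν := by
  have hi := (hh.smul_measure (c := (c : ℝ≥0∞)) ENNReal.coe_ne_top)
  rw [← integral_map (φ := g) (f := fun x => ‖h x‖) hg.aemeasurable
    (hi.mono_measure hmap).norm.aestronglyMeasurable]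
  refine (integral_mono_measure hmap (Eventually.of_forall fun x => norm_nonneg _) hi.norm).trans ?_
  rw [integral_smul_nnreal_measure]
  rfl

theorem MeasureTheory.AEStronglyMeasurable.clm_apply_apply {α E F : Type*} [MeasurableSpace α]
    {μ : Measure α} [NormedAddCommGroup E] [NormedSpace ℝ E] [NormedAddCommGroup F]
    [NormedSpace ℝ F] {A : α → E →L[ℝ] F} {x : α → E} (hA : AEStronglyMeasurable A μ)
    (hx : AEStronglyMeasurable x μ) : AEStronglyMeasurable (fun t => A t (x t)) μ :=
  (isBoundedBilinearMap_apply (𝕜 := ℝ) (E := E) (F := F)).continuous.comp_aestronglyMeasurable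
    (hA.prodMk hx)

/-- The passage to the limit in the weak chain rule. -/
theorem tendsto_integral_smul_clm_apply {α E F F' : Type*} [MeasurableSpace α] {μ : Measure α}
    [NormedAddCommGroup E] [NormedSpace ℝ E] [NormedAddCommGroup F] [NormedSpace ℝ F]
    [NormedAddCommGroup F'] [NormedSpace ℝ F'] {φ : α → ℝ} {P : ℕ → α → F →L[ℝ] F'}
    {Q : α → F →L[ℝ] F'} {v : ℕ → α → E →L[ℝ] F} {w : α → E →L[ℝ] F} {d : α → E} {M₁ M₂ M₃ : ℝ}
    (hφm : AEStronglyMeasurable φ μ) (hφ : ∀ x, ‖φ x‖ ≤ M₁)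
    (hPm : ∀ k, AEStronglyMeasurable (P k) μ) (hP : ∀ k x, ‖P k x‖ ≤ M₂)
    (hPQ : ∀ᵐ x ∂μ, Tendsto (fun k => P k x) atTop (𝓝 (Q x)))
    (hdm : AEStronglyMeasurable d μ) (hd : ∀ x, ‖d x‖ ≤ M₃)
    (hv : ∀ k, Integrable (v k) μ) (hw : Integrable w μ)
    (hvw : Tendsto (fun k => ∫ x, ‖v k x - w x‖ ∂μ) atTop (𝓝 0)) :
    Tendsto (fun k => ∫ x, φ x • P k x (v k x (d x)) ∂μ) atTop
      (𝓝 (∫ x, φ x • Q x (w x (d x)) ∂μ)) := by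
  have bound : ∀ k x (z : E →L[ℝ] F), ‖φ x • P k x (z (d x))‖ ≤ M₁ * M₂ * M₃ * ‖z‖ := by
    intro k x z
    have h1 := norm_nonneg (φ x)
    have h2 := norm_nonneg (P k x)
    have h3 := norm_nonneg (d x)
    have h4 := norm_nonneg z
    calc ‖φ x • P k x (z (d x))‖ ≤ ‖φ x‖ * (‖P k x‖ * (‖z‖ * ‖d x‖)) := by
          rw [norm_smul]
          gcongr
          exact (P k x).le_of_opNorm_le_of_le le_rfl (z.le_opNorm _)
      _ ≤ M₁ * (M₂ * (‖z‖ * M₃)) := by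
          have := hφ x
          have := hP k x
          have := hd x
          have : 0 ≤ M₁ := h1.trans (hφ x)
          have : 0 ≤ M₂ := h2.trans (hP k x)
          gcongr
      _ = _ := by ring
  have m1 : ∀ k, AEStronglyMeasurable (fun x => φ x • P k x (v k x (d x))) μ := fun k =>
    hφm.smul ((hPm k).clm_apply_apply ((hv k).aestronglyMeasurable.clm_apply_apply hdm))
  have m2 : ∀ k, AEStronglyMeasurable (fun x => φ x • P k x (w x (d x))) μ := fun k =>
    hφm.smul ((hPm k).clm_apply_apply (hw.aestronglyMeasurable.clm_apply_apply hdm))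
  have i1 : ∀ k, Integrable (fun x => φ x • P k x (v k x (d x))) μ := fun k =>
    ((hv k).norm.const_mul (M₁ * M₂ * M₃)).mono' (m1 k)
      (Eventually.of_forall fun x => bound k x (v k x))
  have i2 : ∀ k, Integrable (fun x => φ x • P k x (w x (d x))) μ := fun k =>
    (hw.norm.const_mul (M₁ * M₂ * M₃)).mono' (m2 k)
      (Eventually.of_forall fun x => bound k x (w x))
  -- With `w` in place of `v k` the integrands converge almost everywhere under a fixed dominating
  -- function.
  have t1 : Tendsto (fun k => ∫ x, φ x • P k x (w x (d x)) ∂μ) atTop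
      (𝓝 (∫ x, φ x • Q x (w x (d x)) ∂μ)) := by
    apply tendsto_integral_of_dominated_convergence (fun x => M₁ * M₂ * M₃ * ‖w x‖) m2
      (hw.norm.const_mul _)
    · exact fun k => Eventually.of_forall fun x => bound k x (w x)
    · filter_upwards [hPQ] with x hx
      have : Tendsto (fun k => P k x (w x (d x))) atTop (𝓝 (Q x (w x (d x)))) :=
        ((ContinuousLinearMap.apply ℝ F' (w x (d x))).continuous.tendsto _).comp hx
      exact this.const_smul _
  -- The error of that replacement is bounded by a constant times the `L¹` distance of `v k` and
  -- `w`.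
  have t2 : Tendsto (fun k => ∫ x, φ x • P k x (v k x (d x)) ∂μ -
      ∫ x, φ x • P k x (w x (d x)) ∂μ) atTop (𝓝 0) := by
    have := hvw.const_mul (M₁ * M₂ * M₃)
    rw [mul_zero] at this
    refine squeeze_zero_norm (fun k => ?_) this
    rw [← integral_sub (i1 k) (i2 k), ← integral_const_mul]
    refine (norm_integral_le_integral_norm _).trans ?_
    apply integral_mono (((i1 k).sub (i2 k)).norm) (((hv k).sub hw).norm.const_mul _)
    intro x
    have := bound k x (v k x - w x)
    rw [sub_apply, map_sub, smul_sub] at this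
    exact this
  simpa using t2.add t1

/-- The weak chain rule for the composition `Φ ∘ u ∘ g` of a weakly differentiable function `u`
with a compactly supported `C¹` function `Φ` from the left and with a Lipschitz change of variables
`g` from the right. -/
theorem HasWeakDerivOn.comp_contDiff_comp_lipschitz [FiniteDimensional ℝ F] {F' : Type*}
    [NormedAddCommGroup F'] [NormedSpace ℝ F'] [FiniteDimensional ℝ F']
    {Ω Ω' : Set (RSpace n)} (hΩ : IsOpen Ω) (hΩ' : IsOpen Ω')
    {g : RSpace n → RSpace n} {K : ℝ≥0} (hg : LipschitzWith K g) (hgm : MapsTo g Ω' Ω) {c : ℝ≥0}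
    (hmap : Measure.map g (volume.restrict Ω') ≤ c • volume.restrict Ω)
    {u : RSpace n → F} {v : RSpace n → RSpace n →L[ℝ] F} (h : HasWeakDerivOn Ω u v)
    {Φ : F → F'} (hΦ : ContDiff ℝ 1 Φ) (hΦc : HasCompactSupport Φ) :
    HasWeakDerivOn Ω' (fun y => Φ (u (g y)))
      (fun y => (fderiv ℝ Φ (u (g y))).comp ((v (g y)).comp (fderiv ℝ g y))) := by
  have : CompleteSpace F := FiniteDimensional.complete ℝ F
  have : CompleteSpace F' := FiniteDimensional.complete ℝ F'
  have hgmeas : Measurable g := hg.continuous.measurable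
  obtain ⟨M, hM⟩ := hΦc.exists_bound_of_continuous hΦ.continuous
  obtain ⟨M', hM'⟩ := (hΦc.fderiv ℝ).exists_bound_of_continuous (hΦ.continuous_fderiv (by simp))
  have hdg : ∀ y, ‖fderiv ℝ g y‖ ≤ K := fun y => norm_fderiv_le_of_lipschitz ℝ hg
  have hdgm : Measurable (fderiv ℝ g) := measurable_fderiv ℝ g
  have hum : AEStronglyMeasurable (fun y => u (g y)) (volume.restrict Ω') :=
    h.1.aestronglyMeasurable.comp_quasiMeasurePreserving
      (quasiMeasurePreserving_of_map_le_smul hgmeas hmap)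
  have hvm : AEStronglyMeasurable (fun y => v (g y)) (volume.restrict Ω') :=
    h.2.aestronglyMeasurable.comp_quasiMeasurePreserving
      (quasiMeasurePreserving_of_map_le_smul hgmeas hmap)
  have hΦm : AEStronglyMeasurable (fun y => fderiv ℝ Φ (u (g y))) (volume.restrict Ω') :=
    (hΦ.continuous_fderiv (by simp)).comp_aestronglyMeasurable hum
  have hvint : ∀ S' ⊆ Ω', IsCompact S' → IntegrableOn (fun y => v (g y)) S' volume := by
    intro S' hS' hc
    have hS : g '' S' ⊆ Ω := (hgm.mono_left hS').image_subset
    have hSc : IsCompact (g '' S') := hc.image hg.continuous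
    exact integrable_comp_of_map_le_smul hgmeas (map_restrict_le_of_mapsTo hgmeas hmap
      hS' hSc.isClosed.measurableSet (mapsTo_image g S'))
      (h.2.integrableOn_compact_subset hS hSc)
  refine ⟨?_, ?_, ?_⟩
  · rw [locallyIntegrableOn_iff hΩ'.isLocallyClosed]
    intro S' hS' hc
    refine Integrable.mono' (g := fun _ => M) (integrableOn_const hc.measure_lt_top.ne) ?_
      (Eventually.of_forall fun y => hM _)
    exact (hΦ.continuous.comp_aestronglyMeasurable hum).mono_measure
      (Measure.restrict_mono hS' le_rfl)
  · rw [locallyIntegrableOn_iff hΩ'.isLocallyClosed]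
    intro S' hS' hc
    refine Integrable.mono' (g := fun y => M' * (‖v (g y)‖ * K))
      (((hvint S' hS' hc).norm.mul_const _).const_mul _) ?_ (Eventually.of_forall fun y => ?_)
    · refine AEStronglyMeasurable.mono_measure ?_ (Measure.restrict_mono hS' le_rfl)
      exact isBoundedBilinearMap_comp.continuous.comp_aestronglyMeasurable (hΦm.prodMk
        (isBoundedBilinearMap_comp.continuous.comp_aestronglyMeasurable
          (hvm.prodMk hdgm.aestronglyMeasurable)))
    · refine (ContinuousLinearMap.opNorm_comp_le _ _).trans ?_
      have : 0 ≤ M' := (norm_nonneg _).trans (hM' 0)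
      gcongr
      · exact hM' _
      · refine (ContinuousLinearMap.opNorm_comp_le _ _).trans ?_
        gcongr
        exact hdg y
  · intro φ hφ hφc hφs w
    -- All integrals live on the compact support of `φ`, so approximating `u` near its compact image
    -- under `g` suffices.
    set S' := tsupport φ with hS'
    have hS'c : IsCompact S' := hφc
    set S := g '' S' with hSdef
    have hSc : IsCompact S := hS'c.image hg.continuous
    have hSΩ : S ⊆ Ω := (hgm.mono_left hφs).image_subset
    have hmapS : Measure.map g (volume.restrict S') ≤ c • volume.restrict S :=
      map_restrict_le_of_mapsTo hgmeas hmap hφs hSc.isClosed.measurableSet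
        (mapsTo_image g S')
    obtain ⟨a, ha, hac, hlim, hlim'⟩ := h.exists_contDiff_tendsto hΩ hSc hSΩ
    have hcd : Continuous fun x => fderiv ℝ φ x w :=
      (hφ.continuous_fderiv (by simp)).clm_apply continuous_const
    obtain ⟨M₁, hM₁⟩ := hφc.exists_bound_of_continuous hφ.continuous
    have hconv : ∀ᵐ y ∂(volume.restrict S'),
        Tendsto (fun k => a k (g y)) atTop (𝓝 (u (g y))) := by
      have := (quasiMeasurePreserving_of_map_le_smul hgmeas hmapS).ae
        ((ae_restrict_iff' hSc.isClosed.measurableSet).2 hlim)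
      exact this
    -- `Φ ∘ a k ∘ g` is Lipschitz, because `Φ` and `a k` are `C¹` with compact support. The
    -- classical chain rule therefore holds wherever `g` is differentiable.
    have eqk : ∀ k, ∫ y in S', fderiv ℝ φ y w • Φ (a k (g y)) =
        - ∫ y in S', φ y • fderiv ℝ Φ (a k (g y)) (fderiv ℝ (a k) (g y) (fderiv ℝ g y w)) := by
      intro k
      obtain ⟨C₁, hC₁⟩ := hΦ.lipschitzWith_of_hasCompactSupport hΦc (by simp)
      obtain ⟨C₂, hC₂⟩ := (ha k).lipschitzWith_of_hasCompactSupport (hac k) (by simp)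
      have := (hC₁.comp (hC₂.comp hg)).integral_fderiv_smul_eq hφ hφc w
      rw [setIntegral_smul_eq_integral_of_tsupport_subset hS'.ge,
        setIntegral_smul_eq_integral_of_tsupport_subset
          ((tsupport_fderiv_apply_subset ℝ w).trans hS'.ge)]
      refine this.trans ?_
      congr 1
      apply integral_congr_ae
      filter_upwards [hg.ae_differentiableAt (μ := volume)] with y hy
      have d1 := (hΦ.differentiable (by simp) (a k (g y))).hasFDerivAt
      have d2 := ((ha k).differentiable (by simp) (g y)).hasFDerivAt
      have d3 : HasFDerivAt (Φ ∘ a k ∘ g) _ y := d1.comp y (d2.comp y hy.hasFDerivAt)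
      rw [d3.fderiv]
      simp
    have tl : Tendsto (fun k => ∫ y in S', fderiv ℝ φ y w • Φ (a k (g y))) atTop
        (𝓝 (∫ y in S', fderiv ℝ φ y w • Φ (u (g y)))) := by
      apply tendsto_integral_of_dominated_convergence (fun y => ‖fderiv ℝ φ y w‖ * M)
      · intro k
        exact (hcd.smul (hΦ.continuous.comp ((ha k).continuous.comp
          hg.continuous))).aestronglyMeasurable
      · exact ((hcd.norm.mul continuous_const).continuousOn).integrableOn_compact hS'c
      · intro k
        refine Eventually.of_forall fun y => ?_
        rw [norm_smul]
        gcongr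
        exact hM _
      · filter_upwards [hconv] with y hy
        exact ((hΦ.continuous.tendsto _).comp hy).const_smul _
    have tr : Tendsto (fun k => ∫ y in S', φ y • fderiv ℝ Φ (a k (g y))
        (fderiv ℝ (a k) (g y) (fderiv ℝ g y w))) atTop
        (𝓝 (∫ y in S', φ y • fderiv ℝ Φ (u (g y)) (v (g y) (fderiv ℝ g y w)))) := by
      have hda : ∀ k, Continuous (fderiv ℝ (a k)) := fun k => (ha k).continuous_fderiv (by simp)
      apply tendsto_integral_smul_clm_apply (M₁ := M₁) (M₂ := M') (M₃ := K * ‖w‖)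
        (P := fun k y => fderiv ℝ Φ (a k (g y))) (v := fun k y => fderiv ℝ (a k) (g y))
        (Q := fun y => fderiv ℝ Φ (u (g y))) (w := fun y => v (g y)) (d := fun y => fderiv ℝ g y w)
      · exact hφ.continuous.aestronglyMeasurable
      · exact hM₁
      · intro k
        exact ((hΦ.continuous_fderiv (by simp)).comp ((ha k).continuous.comp
          hg.continuous)).aestronglyMeasurable
      · exact fun k x => hM' _
      · filter_upwards [hconv] with y hy
        exact ((hΦ.continuous_fderiv (by simp)).tendsto _).comp hy
      · exact (hdgm.apply_continuousLinearMap w).aestronglyMeasurable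
      · exact fun y => (fderiv ℝ g y).le_of_opNorm_le (hdg y) w
      · intro k
        exact (((hda k).comp hg.continuous).continuousOn).integrableOn_compact hS'c
      · exact hvint S' hφs hS'c
      · have := hlim'.const_mul (c : ℝ)
        rw [mul_zero] at this
        refine squeeze_zero (fun k => integral_nonneg fun x => norm_nonneg _) (fun k => ?_) this
        exact integral_norm_comp_le_of_map_le_smul hgmeas hmapS
          (((hda k).continuousOn.integrableOn_compact hSc).sub
            (h.2.integrableOn_compact_subset hSΩ hSc))
    simp_rw [eqk] at tl
    have key := tendsto_nhds_unique tl tr.neg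
    rw [setIntegral_smul_eq_integral_of_tsupport_subset hS'.ge,
      setIntegral_smul_eq_integral_of_tsupport_subset
        ((tsupport_fderiv_apply_subset ℝ w).trans hS'.ge)] at key
    rw [setIntegral_smul_eq_integral_of_tsupport_subset hφs,
      setIntegral_smul_eq_integral_of_tsupport_subset
        ((tsupport_fderiv_apply_subset ℝ w).trans hφs)]
    exact key

end WeakDerivatives

section RearrangementInvariant

variable {n : ℕ}

/-! ### Volume under Lipschitz maps and smooth matrix inversion. -/

/-- Lebesgue measure is a constant multiple of the `n`-dimensional Hausdorff measure, for which the
estimate is immediate; the constant cancels. -/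
theorem LipschitzOnWith.volume_image_le {f : RSpace n → RSpace n} {K : ℝ≥0} {s : Set (RSpace n)}
    (hf : LipschitzOnWith K f s) : volume (f '' s) ≤ (K ^ n : ℝ≥0) * volume s := by
  have hH : (Measure.hausdorffMeasure (n : ℝ) : Measure (RSpace n)).IsAddHaarMeasure := by
    simpa using isAddHaarMeasure_hausdorffMeasure (E := RSpace n)
  have h := hf.hausdorffMeasure_image_le (d := n) (Nat.cast_nonneg n)
  rw [Measure.isAddLeftInvariant_eq_smul (volume : Measure (RSpace n))
    (Measure.hausdorffMeasure (n : ℝ)), Measure.smul_apply, Measure.smul_apply]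
  set c := Measure.addHaarScalarFactor (volume : Measure (RSpace n))
    (Measure.hausdorffMeasure (n : ℝ))
  calc (c : ℝ≥0∞) * Measure.hausdorffMeasure (n : ℝ) (f '' s)
      ≤ c * ((K : ℝ≥0∞) ^ (n : ℝ) * Measure.hausdorffMeasure (n : ℝ) s) := by gcongr
    _ = (K ^ n : ℝ≥0) * (c * Measure.hausdorffMeasure (n : ℝ) s) := by
      rw [ENNReal.rpow_natCast, ENNReal.coe_pow]; ring

theorem map_restrict_le_of_lipschitzOnWith_leftInverse {f g : RSpace n → RSpace n} {K : ℝ≥0}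
    {Ω Ω' : Set (RSpace n)} (hf : LipschitzOnWith K f Ω) (hg : Measurable g)
    (hm : MapsTo g Ω' Ω) (hfg : ∀ y ∈ Ω', f (g y) = y) :
    Measure.map g (volume.restrict Ω') ≤ (K ^ n : ℝ≥0) • volume.restrict Ω := by
  refine Measure.le_iff.2 fun s hs => ?_
  rw [Measure.map_apply hg hs, Measure.restrict_apply (hg hs), Measure.smul_apply,
    Measure.restrict_apply hs]
  refine le_trans (measure_mono ?_) (hf.mono (inter_subset_right (s := s))).volume_image_le
  rintro y ⟨hy, hy'⟩
  exact ⟨g y, ⟨hy, hm hy'⟩, hfg y hy'⟩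

/-- A smooth compactly supported function which agrees with the inversion of matrices on the set of
all matrices which are bounded, together with their inverse, by a given constant. -/
theorem exists_contDiff_hasCompactSupport_eq_inverse (L : ℝ) :
    ∃ Φ : (RSpace n →L[ℝ] RSpace n) → (RSpace n →L[ℝ] RSpace n), ContDiff ℝ 1 Φ ∧
      HasCompactSupport Φ ∧ ∀ A B : RSpace n →L[ℝ] RSpace n, ‖A‖ ≤ L → ‖B‖ ≤ L →
        A * B = 1 → Φ A = B := by
  set R := RSpace n →L[ℝ] RSpace n
  have : ProperSpace R := FiniteDimensional.proper ℝ R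
  set K : Set R := Prod.fst '' ((Metric.closedBall (0 : R) L ×ˢ Metric.closedBall (0 : R) L) ∩
    {p | p.1 * p.2 = 1 ∧ p.2 * p.1 = 1}) with hK
  have hKc : IsCompact K := by
    refine IsCompact.image ?_ continuous_fst
    refine ((isCompact_closedBall _ _).prod (isCompact_closedBall _ _)).inter_right ?_
    exact (isClosed_eq (by fun_prop) continuous_const).inter
      (isClosed_eq (by fun_prop) continuous_const)
  have hKU : K ⊆ {A : R | IsUnit A} := by
    rintro _ ⟨⟨A, B⟩, ⟨-, h1, h2⟩, rfl⟩
    exact ⟨⟨A, B, h1, h2⟩, rfl⟩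
  -- The cutoff equals one on `K` and its closed support lies in `K'`, a compact set of invertible
  -- matrices, where inversion is smooth.
  obtain ⟨K', hK'c, hKK', hK'U⟩ := exists_compact_between hKc Units.isOpen hKU
  obtain ⟨χ, hχ, -, hχs, hχ1⟩ := exists_contMDiff_support_eq_eq_one_iff (modelWithCornersSelf ℝ R)
    (n := 1) isOpen_interior hKc.isClosed hKK'
  rw [contMDiff_iff_contDiff] at hχ
  have hχt : tsupport χ ⊆ K' := by
    rw [tsupport, hχs]
    exact hK'c.isClosed.closure_interior_subset
  have hts : tsupport (fun A => χ A • Ring.inverse A) ⊆ tsupport χ :=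
    tsupport_smul_subset_left χ Ring.inverse
  refine ⟨fun A => χ A • Ring.inverse A, ?_, ?_, ?_⟩
  · rw [← contMDiff_iff_contDiff]
    apply contMDiff_of_tsupport
    intro A hA
    rw [contMDiffAt_iff_contDiffAt]
    obtain ⟨U, hU⟩ := hK'U (hχt (hts hA))
    have := contDiffAt_ringInverse ℝ (n := 1) U
    rw [hU] at this
    exact hχ.contDiffAt.smul this
  · exact hK'c.of_isClosed_subset (isClosed_tsupport _) (hts.trans hχt)
  · intro A B hA hB hAB
    -- In finite dimension a one-sided inverse is two-sided.
    have hBA : B * A = 1 := by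
      have h1 : (A : RSpace n →ₗ[ℝ] RSpace n) * (B : RSpace n →ₗ[ℝ] RSpace n) = 1 := by
        ext1 x
        exact DFunLike.congr_fun hAB x
      have h2 := mul_eq_one_comm.1 h1
      ext1 x
      exact DFunLike.congr_fun h2 x
    have hAK : A ∈ K := ⟨(A, B), ⟨⟨by simpa using hA, by simpa using hB⟩, hAB, hBA⟩, rfl⟩
    have h1 := (hχ1 A).1 hAK
    have h2 : Ring.inverse A = B := Ring.inverse_unit ⟨A, B, hAB, hBA⟩
    simp only [h1, h2, one_smul]

/-! ### Nonatomicity, and comparison of norms by distribution functions. -/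

/-- Intermediate value theorem for `r ↦ |A ∩ B(0, r)|`, which is continuous because its increments
are at most those of `|B(0, r)|`. It starts at `0` because points are null in positive dimension. -/
theorem exists_subset_volume_eq [NeZero n] {A : Set (RSpace n)} (hA : MeasurableSet A)
    (hfin : volume A ≠ ⊤) {t : ℝ≥0∞} (ht : t ≤ volume A) :
    ∃ B ⊆ A, MeasurableSet B ∧ volume B = t := by
  rcases ht.eq_or_lt with rfl | ht
  · exact ⟨A, Subset.rfl, hA, rfl⟩
  have hmono : Monotone fun k : ℕ => A ∩ Metric.closedBall (0 : RSpace n) k := fun i j hij =>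
    inter_subset_inter_right _ (Metric.closedBall_subset_closedBall (by exact_mod_cast hij))
  have hlim := tendsto_measure_iUnion_atTop (μ := volume) hmono
  rw [← inter_iUnion, Metric.iUnion_closedBall_nat, inter_univ] at hlim
  obtain ⟨R, hR⟩ := (hlim.eventually (lt_mem_nhds ht)).exists
  have hfin' : ∀ r : ℝ, volume (A ∩ Metric.closedBall (0 : RSpace n) r) ≠ ⊤ := fun r =>
    measure_ne_top_of_subset inter_subset_left hfin
  have hle : ∀ r s : ℝ, 0 ≤ r → r ≤ s →
      dist (volume.real (A ∩ Metric.closedBall (0 : RSpace n) r))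
        (volume.real (A ∩ Metric.closedBall (0 : RSpace n) s)) ≤
      dist (r ^ n * volume.real (Metric.ball (0 : RSpace n) 1))
        (s ^ n * volume.real (Metric.ball (0 : RSpace n) 1)) := by
    intro r s hr hrs
    have hsub := Metric.closedBall_subset_closedBall (x := (0 : RSpace n)) hrs
    have e := fun r (hr : (0 : ℝ) ≤ r) =>
      Measure.addHaar_real_closedBall (volume : Measure (RSpace n)) 0 hr
    simp only [finrank_euclideanSpace, Fintype.card_fin] at e
    rw [← e r hr, ← e s (hr.trans hrs), dist_comm, dist_comm (volume.real (Metric.closedBall _ r)),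
      Real.dist_eq, Real.dist_eq]
    refine le_trans (le_of_eq (abs_of_nonneg ?_)) (le_trans ?_ (le_abs_self _))
    · exact sub_nonneg.2 (measureReal_mono (inter_subset_inter_right _ hsub) (hfin' s))
    · rw [← measureReal_sdiff (inter_subset_inter_right _ hsub)
        (hA.inter Metric.isClosed_closedBall.measurableSet) (hfin' s),
        ← measureReal_sdiff hsub Metric.isClosed_closedBall.measurableSet
        measure_closedBall_lt_top.ne]
      apply measureReal_mono _ (measure_ne_top_of_subset sdiff_subset measure_closedBall_lt_top.ne)
      rintro x ⟨⟨hx1, hx2⟩, hx3⟩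
      exact ⟨hx2, fun h => hx3 ⟨hx1, h⟩⟩
  have hcont : ContinuousOn (fun r : ℝ => volume.real (A ∩ Metric.closedBall (0 : RSpace n) r))
      (Icc 0 (R : ℝ)) := by
    intro r hr
    have hc : Continuous fun s : ℝ => s ^ n * volume.real (Metric.ball (0 : RSpace n) 1) := by
      fun_prop
    have h0 := tendsto_iff_dist_tendsto_zero.1 (hc.continuousWithinAt (s := Icc 0 (R : ℝ)) (x := r))
    refine tendsto_iff_dist_tendsto_zero.2 (squeeze_zero' (Eventually.of_forall fun _ =>
      dist_nonneg) ?_ h0)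
    filter_upwards [self_mem_nhdsWithin] with s hs
    rcases le_total s r with h | h
    · exact hle s r hs.1 h
    · rw [dist_comm, dist_comm (s ^ n * _)]
      exact hle r s hr.1 h
  have ht' : t ≠ ⊤ := ht.ne_top
  obtain ⟨r, -, hr⟩ := intermediate_value_Icc (Nat.cast_nonneg R) hcont (show t.toReal ∈ _ from by
    constructor
    · have : volume.real (A ∩ Metric.closedBall (0 : RSpace n) 0) = 0 := by
        have : Nonempty (Fin n) := ⟨0⟩
        rw [measureReal_def, measure_mono_null inter_subset_right, ENNReal.toReal_zero]
        rw [Metric.closedBall_zero]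
        exact measure_singleton 0
      simp only [this]
      exact ENNReal.toReal_nonneg
    · exact ENNReal.toReal_mono (hfin' R) hR.le)
  refine ⟨A ∩ Metric.closedBall 0 r, inter_subset_left,
    hA.inter Metric.isClosed_closedBall.measurableSet, ?_⟩
  rw [← ENNReal.toReal_eq_toReal_iff' (hfin' r) ht']
  exact hr

theorem exists_subset_volume_restrict_eq [NeZero n] {G A : Set (RSpace n)}
    (hG : IsFiniteDomain G) (hA : MeasurableSet A) {t : ℝ≥0∞} (ht : t ≤ volume.restrict G A) :
    ∃ B ⊆ A, MeasurableSet B ∧ volume.restrict G B = t := by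
  rw [Measure.restrict_apply hA] at ht
  obtain ⟨B, hB, hBm, hBt⟩ := exists_subset_volume_eq (hA.inter hG.isOpen.measurableSet)
    (measure_ne_top_of_subset inter_subset_right hG.volume_lt_top.ne) ht
  refine ⟨B, hB.trans inter_subset_left, hBm, ?_⟩
  rw [Measure.restrict_apply hBm, inter_eq_left.2 (hB.trans inter_subset_right), hBt]

theorem MeasureTheory.SimpleFunc.measure_preimage_eq_sum {α : Type*} [MeasurableSpace α]
    (s : SimpleFunc α ℝ≥0∞) (μ : Measure α) (p : ℝ≥0∞ → Prop) [DecidablePred p] :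
    μ {x | p (s x)} = ∑ v ∈ s.range with p v, μ (s ⁻¹' {v}) := by
  rw [sum_measure_preimage_singleton]
  · congr 1
    ext x
    simp
  · exact fun v _ => s.measurableSet_preimage _

/-- Every simple function over a nonatomic measure space can be halved: its distribution function
over a suitable set is one half of its distribution function. -/
theorem MeasureTheory.SimpleFunc.exists_half {α : Type*} [MeasurableSpace α] {μ : Measure α}
    (hμ : ∀ A, MeasurableSet A → ∀ t ≤ μ A, ∃ B ⊆ A, MeasurableSet B ∧ μ B = t)
    (s : SimpleFunc α ℝ≥0∞) :
    ∃ E, MeasurableSet E ∧ ∀ p : ℝ≥0∞ → Prop, μ ({x | p (s x)} ∩ E) = μ {x | p (s x)} / 2 := by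
  classical
  choose B hB hBm hBμ using fun v : ℝ≥0∞ => hμ (s ⁻¹' {v}) (s.measurableSet_preimage _)
    (μ (s ⁻¹' {v}) / 2) ENNReal.half_le_self
  have hE : MeasurableSet (⋃ v ∈ s.range, B v) := Finset.measurableSet_biUnion _ fun v _ => hBm v
  refine ⟨⋃ v ∈ s.range, B v, hE, fun p => ?_⟩
  have hpm : MeasurableSet {x | p (s x)} := s.measurableSet_preimage {v | p v}
  rw [← Measure.restrict_apply hpm, s.measure_preimage_eq_sum, s.measure_preimage_eq_sum,
    ENNReal.div_eq_inv_mul, Finset.mul_sum]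
  refine Finset.sum_congr rfl fun v hv => ?_
  rw [Measure.restrict_apply (s.measurableSet_preimage _), ← ENNReal.div_eq_inv_mul, ← hBμ v]
  congr 1
  ext x
  simp only [mem_inter_iff, mem_iUnion]
  constructor
  · rintro ⟨hx, w, -, hxw⟩
    have h1 : s x = v := hx
    have h2 : s x = w := hB w hxw
    rwa [← h1, h2]
  · exact fun hx => ⟨hB v hx, v, (Finset.mem_filter.1 hv).1, hx⟩

/-- Pairwise disjoint sets of prescribed measures inside of the superlevel sets of a function. -/
theorem exists_disjoint_subset_superlevel {α : Type*} [MeasurableSpace α] {μ : Measure α}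
    [IsFiniteMeasure μ]
    (hμ : ∀ A, MeasurableSet A → ∀ t ≤ μ A, ∃ B ⊆ A, MeasurableSet B ∧ μ B = t)
    {b : α → ℝ≥0∞} (hb : Measurable b) (t : ℝ≥0∞ → ℝ≥0∞) (S : Finset ℝ≥0∞)
    (hS : ∀ v ∈ S, ∑ w ∈ S with v ≤ w, t w ≤ μ {x | v ≤ b x}) :
    ∃ D : ℝ≥0∞ → Set α, (∀ v ∈ S, MeasurableSet (D v) ∧ D v ⊆ {x | v ≤ b x} ∧ μ (D v) = t v) ∧
      (S : Set ℝ≥0∞).PairwiseDisjoint D := by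
  classical
  -- Values are added in decreasing order. The sets already chosen lie in `{x | a ≤ b x}`, and the
  -- hypothesis at `a` says that enough room is left there.
  induction S using Finset.induction_on_min with
  | empty => exact ⟨fun _ => ∅, by simp, by simp⟩
  | insert a S ha ih =>
    have haS : a ∉ S := fun h => lt_irrefl _ (ha a h)
    obtain ⟨D, hD, hdisj⟩ := ih fun v hv => by
      refine le_trans (Finset.sum_le_sum_of_subset ?_) (hS v (Finset.mem_insert_of_mem hv))
      exact Finset.filter_subset_filter _ (Finset.subset_insert _ _)
    set U := ⋃ v ∈ S, D v with hU
    have hUm : MeasurableSet U := Finset.measurableSet_biUnion _ fun v hv => (hD v hv).1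
    have hUsub : U ⊆ {x | a ≤ b x} :=
      iUnion₂_subset fun v hv x hx => (ha v hv).le.trans ((hD v hv).2.1 hx)
    have hUμ : μ U = ∑ v ∈ S, t v := by
      rw [hU, measure_biUnion_finset hdisj fun v hv => (hD v hv).1]
      exact Finset.sum_congr rfl fun v hv => (hD v hv).2.2
    have hta : t a ≤ μ ({x | a ≤ b x} \ U) := by
      rw [measure_sdiff hUsub hUm.nullMeasurableSet (measure_ne_top _ _)]
      apply ENNReal.le_sub_of_add_le_right (measure_ne_top _ _)
      have := hS a (Finset.mem_insert_self _ _)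
      rwa [Finset.filter_true_of_mem, Finset.sum_insert haS, ← hUμ] at this
      intro w hw
      rcases Finset.mem_insert.1 hw with rfl | hw
      · exact le_rfl
      · exact (ha w hw).le
    obtain ⟨B, hB, hBm, hBt⟩ := hμ _ ((hb measurableSet_Ici).diff hUm) _ hta
    refine ⟨Function.update D a B, fun v hv => ?_, ?_⟩
    · rcases Finset.mem_insert.1 hv with rfl | hv
      · simp only [Function.update_self]
        exact ⟨hBm, hB.trans sdiff_subset, hBt⟩
      · rw [Function.update_of_ne (ha v hv).ne']
        exact hD v hv
    · rw [Finset.coe_insert, pairwiseDisjoint_insert_of_notMem (by simpa using haS)]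
      constructor
      · intro v hv w hw hvw
        have hva : v ≠ a := fun h => haS (h ▸ hv)
        have hwa : w ≠ a := fun h => haS (h ▸ hw)
        simpa [Function.onFun, hva, hwa] using hdisj hv hw hvw
      · intro v hv
        have hva : v ≠ a := fun h => haS (h ▸ hv)
        rw [Function.update_self, Function.update_of_ne hva]
        refine disjoint_left.2 fun x hx hx' => (hB hx).2 ?_
        exact mem_biUnion hv hx'

theorem IsFiniteDomain.volume_ne_zero {G : Set (RSpace n)} (hG : IsFiniteDomain G) :
    volume G ≠ 0 :=
  (hG.isOpen.measure_pos volume hG.nonempty).ne'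

theorem IsFiniteDomain.isFiniteMeasure {G : Set (RSpace n)} (hG : IsFiniteDomain G) :
    IsFiniteMeasure (volume.restrict G) :=
  ⟨by simpa using hG.volume_lt_top⟩

/-- The comparison of the norms over two domains, for a simple function. -/
theorem RIBanachFunctionSpace.norm_simpleFunc_le [NeZero n] (X : RIBanachFunctionSpace n)
    {G G' : Set (RSpace n)} (hG : IsFiniteDomain G) (hG' : IsFiniteDomain G')
    (s : SimpleFunc (RSpace n) ℝ≥0∞) {b : RSpace n → ℝ≥0∞} (hb : Measurable b)
    (h : ∀ v ≠ 0, volume.restrict G' {y | v ≤ s y} ≤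
      volume G' / volume G * volume.restrict G {x | v ≤ b x}) :
    X.norm G' s ≤ volume G' / volume G * X.norm G b := by
  classical
  have := hG.isFiniteMeasure
  set η := volume G' / volume G with hη
  have hη0 : η ≠ 0 := ENNReal.div_ne_zero.2 ⟨hG'.volume_ne_zero, hG.volume_lt_top.ne⟩
  have hηt : η ≠ ⊤ := ENNReal.div_ne_top hG'.volume_lt_top.ne hG.volume_ne_zero
  set t : ℝ≥0∞ → ℝ≥0∞ := fun v => η⁻¹ * volume.restrict G' (s ⁻¹' {v}) with ht
  set S := s.range.filter (· ≠ 0) with hS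
  have hsum : ∀ (p : ℝ≥0∞ → Prop) [DecidablePred p], ¬ p 0 →
      ∑ w ∈ S with p w, t w = η⁻¹ * volume.restrict G' {y | p (s y)} := by
    intro p _ hp
    rw [s.measure_preimage_eq_sum, Finset.mul_sum, hS, Finset.filter_filter]
    refine Finset.sum_congr (Finset.filter_congr fun w _ => ?_) fun _ _ => rfl
    exact ⟨fun h => h.2, fun h => ⟨fun h0 => hp (h0 ▸ h), h⟩⟩
  obtain ⟨D, hD, hdisj⟩ := exists_disjoint_subset_superlevel
    (fun A hA t ht => exists_subset_volume_restrict_eq hG hA ht) hb t S (by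
      intro v hv
      have hv0 : v ≠ 0 := (Finset.mem_filter.1 hv).2
      rw [hsum (v ≤ ·) (by simpa using hv0), ← ENNReal.div_eq_inv_mul]
      exact ENNReal.div_le_of_le_mul' (h v hv0))
  -- A copy of `s` on `G` lying below `b`: its level sets have the measures of those of `s` divided
  -- by `η`, which is exactly the relation required by similarity.
  set a : RSpace n → ℝ≥0∞ := fun x => ∑ v ∈ S, (D v).indicator (fun _ => v) x with ha
  have ham : Measurable a :=
    Finset.measurable_fun_sum _ fun v hv => measurable_const.indicator (hD v hv).1
  have haD : ∀ v ∈ S, ∀ x ∈ D v, a x = v := by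
    intro v hv x hx
    rw [ha]
    simp only
    rw [Finset.sum_eq_single_of_mem v hv, indicator_of_mem hx]
    intro w hw hwv
    exact indicator_of_notMem (disjoint_left.1 (hdisj hv hw hwv.symm) hx) _
  have haD' : ∀ x, (∀ v ∈ S, x ∉ D v) → a x = 0 := fun x hx =>
    Finset.sum_eq_zero fun v hv => indicator_of_notMem (hx v hv) _
  have hab : a ≤ b := by
    intro x
    by_cases hx : ∃ v ∈ S, x ∈ D v
    · obtain ⟨v, hv, hxv⟩ := hx
      rw [haD v hv x hxv]
      exact (hD v hv).2.1 hxv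
    · push Not at hx
      rw [haD' x hx]
      exact zero_le
  have hdist : ∀ c : ℝ≥0∞, volume.restrict G {x | c < a x} =
      η⁻¹ * volume.restrict G' {y | c < s y} := by
    intro c
    rw [← hsum (c < ·) (by simp)]
    have : {x | c < a x} = ⋃ v ∈ S.filter (c < ·), D v := by
      ext x
      simp only [mem_ofPred_eq, mem_iUnion, Finset.mem_filter, exists_prop]
      constructor
      · intro hx
        by_contra hcon
        have : a x = 0 := haD' x fun v hv hxv => hcon ⟨v, ⟨hv, by rwa [← haD v hv x hxv]⟩, hxv⟩
        simp [this] at hx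
      · rintro ⟨v, ⟨hv, hcv⟩, hxv⟩
        rwa [haD v hv x hxv]
    rw [this, measure_biUnion_finset (hdisj.subset (Finset.coe_subset.2 (Finset.filter_subset _ _)))
      fun v hv => (hD v (Finset.mem_filter.1 hv).1).1]
    exact Finset.sum_congr rfl fun v hv => (hD v (Finset.mem_filter.1 hv).1).2.2
  have hsim := X.similar G G' hG hG' a s ham.aemeasurable s.measurable.aemeasurable (by
    intro x hx
    have h0 : 0 < volume.real G := ENNReal.toReal_pos hG.volume_ne_zero hG.volume_lt_top.ne
    have h0' : 0 < volume.real G' := ENNReal.toReal_pos hG'.volume_ne_zero hG'.volume_lt_top.ne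
    have hlt : volume.real G' / volume.real G * x < volume.real G' := by
      rw [div_mul_eq_mul_div, div_lt_iff₀ h0]
      exact mul_lt_mul_of_pos_left hx.2 h0'
    rw [dilation, if_pos hlt, rearrangement, rearrangement]
    congr 1
    ext c
    rw [mem_ofPred_eq, mem_ofPred_eq, hdist, ENNReal.ofReal_mul (by positivity),
      ENNReal.ofReal_div_of_pos h0, ofReal_measureReal hG'.volume_lt_top.ne,
      ofReal_measureReal hG.volume_lt_top.ne, ← ENNReal.div_eq_inv_mul,
      ENNReal.div_le_iff' hη0 hηt])
  rw [← hsim]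
  gcongr
  exact (X.isRI G hG).mono a b ham.aemeasurable hb.aemeasurable (Eventually.of_forall hab)

/-- Halving the distribution function of `s` lowers `p` by one, and the triangle inequality for the
two halves doubles the bound. This takes the place of an estimate for dilation operators. The value
`v = 0` must be left out, since a restriction of `s` is nonnegative everywhere and its superlevel
set at `0` does not shrink. -/
theorem RIBanachFunctionSpace.norm_simpleFunc_le_two_pow [NeZero n] (X : RIBanachFunctionSpace n)
    {G G' : Set (RSpace n)} (hG : IsFiniteDomain G) (hG' : IsFiniteDomain G')
    {b : RSpace n → ℝ≥0∞} (hb : Measurable b) (p : ℕ) (s : SimpleFunc (RSpace n) ℝ≥0∞)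
    (h : ∀ v ≠ 0, volume.restrict G' {y | v ≤ s y} ≤
      2 ^ p * (volume G' / volume G * volume.restrict G {x | v ≤ b x})) :
    X.norm G' s ≤ 2 ^ p * (volume G' / volume G * X.norm G b) := by
  have := hG'.isFiniteMeasure
  induction p generalizing s with
  | zero =>
    rw [pow_zero, one_mul]
    exact X.norm_simpleFunc_le hG hG' s hb fun v hv => by simpa using h v hv
  | succ p ih =>
    obtain ⟨E, hE, hhalf⟩ := s.exists_half (μ := volume.restrict G')
      (fun A hA t ht => exists_subset_volume_restrict_eq hG' hA ht)
    have hhalf' : ∀ p : ℝ≥0∞ → Prop, volume.restrict G' ({x | p (s x)} ∩ Eᶜ) =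
        volume.restrict G' {x | p (s x)} / 2 := by
      intro p
      have h1 := measure_inter_add_sdiff (μ := volume.restrict G') {x | p (s x)} hE
      rw [hhalf p, sdiff_eq] at h1
      have h2 := ENNReal.add_halves (volume.restrict G' {x | p (s x)})
      refine (ENNReal.add_right_inj ?_).1 (h1.trans h2.symm)
      exact ENNReal.div_ne_top (measure_ne_top _ _) two_ne_zero
    have key : ∀ E : Set (RSpace n), MeasurableSet E →
        (∀ p : ℝ≥0∞ → Prop, volume.restrict G' ({x | p (s x)} ∩ E) =
          volume.restrict G' {x | p (s x)} / 2) →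
        X.norm G' (s.restrict E) ≤ 2 ^ p * (volume G' / volume G * X.norm G b) := by
      intro E hE hEh
      apply ih
      intro v hv
      have : {y | v ≤ s.restrict E y} = {y | v ≤ s y} ∩ E := by
        ext y
        by_cases hy : y ∈ E <;> simp [SimpleFunc.restrict_apply _ hE, hy, hv]
      rw [this, hEh (v ≤ ·)]
      apply ENNReal.div_le_of_le_mul'
      rw [← mul_assoc, ← pow_succ']
      exact h v hv
    have hadd := (X.isRI G' hG').add_le (s.restrict E) (s.restrict Eᶜ)
      (s.restrict E).measurable.aemeasurable (s.restrict Eᶜ).measurable.aemeasurable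
    have hs : (fun x => s.restrict E x + s.restrict Eᶜ x) = s := by
      ext x
      rw [SimpleFunc.restrict_apply _ hE, SimpleFunc.restrict_apply _ hE.compl]
      exact congrFun (indicator_self_add_compl E s) x
    rw [hs] at hadd
    refine hadd.trans ((add_le_add (key E hE hhalf) (key Eᶜ hE.compl hhalf')).trans ?_)
    rw [pow_succ', mul_assoc, two_mul]

/-- In an r.i. Banach function space, an inequality between distribution functions, up to a constant
factor, implies that the norms are comparable. -/
theorem RIBanachFunctionSpace.norm_lt_top_of_measure_le [NeZero n] (X : RIBanachFunctionSpace n)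
    {G G' : Set (RSpace n)} (hG : IsFiniteDomain G) (hG' : IsFiniteDomain G')
    {b k : RSpace n → ℝ≥0∞} (hb : Measurable b) (hk : Measurable k) {c : ℝ≥0}
    (h : ∀ v, volume.restrict G' {y | v ≤ k y} ≤ c * volume.restrict G {x | v ≤ b x})
    (hfin : X.norm G b < ⊤) : X.norm G' k < ⊤ := by
  set η := volume G' / volume G with hη
  have hη0 : η ≠ 0 := ENNReal.div_ne_zero.2 ⟨hG'.volume_ne_zero, hG.volume_lt_top.ne⟩
  have hηt : η ≠ ⊤ := ENNReal.div_ne_top hG'.volume_lt_top.ne hG.volume_ne_zero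
  -- Any natural number exceeding `c / η` serves as `p`, as `N < 2 ^ N`.
  obtain ⟨p, hp⟩ : ∃ p : ℕ, (c : ℝ≥0∞) ≤ 2 ^ p * η := by
    obtain ⟨N, hN⟩ := ENNReal.exists_nat_gt (ENNReal.div_ne_top (ENNReal.coe_ne_top (r := c)) hη0)
    refine ⟨N, ?_⟩
    rw [← ENNReal.div_le_iff hη0 hηt]
    refine hN.le.trans ?_
    exact_mod_cast Nat.lt_two_pow_self.le
  have hle : ∀ j, X.norm G' (SimpleFunc.eapprox k j) ≤ 2 ^ p * (η * X.norm G b) := by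
    intro j
    refine X.norm_simpleFunc_le_two_pow hG hG' hb p _ fun v _ => ?_
    calc volume.restrict G' {y | v ≤ SimpleFunc.eapprox k j y}
        ≤ volume.restrict G' {y | v ≤ k y} :=
          measure_mono fun y hy => le_trans hy ((le_iSup (fun j =>
            SimpleFunc.eapprox k j y) j).trans_eq (SimpleFunc.iSup_eapprox_apply hk y))
      _ ≤ c * volume.restrict G {x | v ≤ b x} := h v
      _ ≤ 2 ^ p * η * volume.restrict G {x | v ≤ b x} := by gcongr
      _ = _ := mul_assoc _ _ _
  have hlim := (X.isRI G' hG').fatou (fun j => SimpleFunc.eapprox k j) k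
    (fun j => (SimpleFunc.eapprox k j).measurable.aemeasurable) hk.aemeasurable
    (Eventually.of_forall fun x i j hij => SimpleFunc.monotone_eapprox k hij x)
    (Eventually.of_forall fun x => SimpleFunc.tendsto_eapprox hk x)
  refine (le_of_tendsto' hlim hle).trans_lt ?_
  exact ENNReal.mul_lt_top (by finiteness) (ENNReal.mul_lt_top hηt.lt_top hfin)

/-! ### Membership criteria for `X(G)`. -/

theorem IsFiniteDomain.of_isCompact_closure {G : Set (RSpace n)} (hG : IsOpen G)
    (hne : G.Nonempty) (hc : IsCompact (closure G)) : IsFiniteDomain G :=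
  ⟨hG, hne, (measure_mono subset_closure).trans_lt hc.measure_lt_top⟩

theorem RIBanachFunctionSpace.norm_congr_ae (X : RIBanachFunctionSpace n) {G : Set (RSpace n)}
    (hG : IsFiniteDomain G) {b k : RSpace n → ℝ≥0∞} (hb : AEMeasurable b (volume.restrict G))
    (hk : AEMeasurable k (volume.restrict G)) (h : b =ᵐ[volume.restrict G] k) :
    X.norm G b = X.norm G k :=
  le_antisymm ((X.isRI G hG).mono _ _ hb hk h.le) ((X.isRI G hG).mono _ _ hk hb h.symm.le)

theorem RIBanachFunctionSpace.Mem.of_norm_le_const_mul (X : RIBanachFunctionSpace n)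
    {G : Set (RSpace n)} (hG : IsFiniteDomain G) {H : Type*} [NormedAddCommGroup H]
    {w : RSpace n → H} (hw : AEStronglyMeasurable w (volume.restrict G)) {b : RSpace n → ℝ≥0∞}
    (hb : AEMeasurable b (volume.restrict G)) (hfin : X.norm G b < ⊤) (C : ℝ≥0)
    (hle : ∀ᵐ x ∂(volume.restrict G), ‖w x‖ₑ ≤ C * b x) : X.Mem G w := by
  refine ⟨hw, ((X.isRI G hG).mono _ _ hw.enorm (hb.const_mul _) hle).trans_lt ?_⟩
  rw [(X.isRI G hG).smul C b hb]
  exact ENNReal.mul_lt_top ENNReal.coe_lt_top hfin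

theorem RIBanachFunctionSpace.Mem.of_norm_le_const (X : RIBanachFunctionSpace n)
    {G : Set (RSpace n)} (hG : IsFiniteDomain G) {H : Type*} [NormedAddCommGroup H]
    {w : RSpace n → H} (hw : AEStronglyMeasurable w (volume.restrict G)) (C : ℝ≥0)
    (hle : ∀ᵐ x ∂(volume.restrict G), ‖w x‖ ≤ C) : X.Mem G w := by
  refine RIBanachFunctionSpace.Mem.of_norm_le_const_mul X hG hw
    (b := univ.indicator fun _ => 1) ?_ ?_ C ?_
  · exact (measurable_const.indicator MeasurableSet.univ).aemeasurable
  · exact (X.isRI G hG).indicator_lt_top univ MeasurableSet.univ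
      (by simpa using hG.volume_lt_top)
  · filter_upwards [hle] with x hx
    have hx' : ‖w x‖₊ ≤ C := hx
    simpa [enorm_le_coe] using hx'

/-- Invariance of r.i. Banach function spaces under bilipschitz changes of variables. -/
theorem RIBanachFunctionSpace.Mem.of_norm_le_const_mul_comp [NeZero n]
    (X : RIBanachFunctionSpace n) {G G' : Set (RSpace n)} (hG : IsFiniteDomain G)
    (hG' : IsFiniteDomain G') {g : RSpace n → RSpace n} (hg : Measurable g) {c : ℝ≥0}
    (hmap : Measure.map g (volume.restrict G') ≤ c • volume.restrict G)
    {H H' : Type*} [NormedAddCommGroup H] [NormedAddCommGroup H'] {v : RSpace n → H}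
    {w : RSpace n → H'} (hv : X.Mem G v) (hw : AEStronglyMeasurable w (volume.restrict G'))
    (C : ℝ≥0) (hle : ∀ᵐ y ∂(volume.restrict G'), ‖w y‖ ≤ C * ‖v (g y)‖) : X.Mem G' w := by
  have hvm := hv.1.enorm
  -- A Borel representative is needed for `b ∘ g` to be measurable; the pushforward bound makes the
  -- exceptional set harmless after composition.
  set b := hvm.mk with hb
  have hbm : Measurable b := hvm.measurable_mk
  refine RIBanachFunctionSpace.Mem.of_norm_le_const_mul X hG' hw (b := fun y => b (g y))
    (hbm.comp hg).aemeasurable ?_ C ?_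
  · refine X.norm_lt_top_of_measure_le hG hG' hbm (hbm.comp hg) (c := c) (fun t => ?_) ?_
    · exact (Measure.le_map_apply hg.aemeasurable {x | t ≤ b x}).trans (Measure.le_iff'.1 hmap _)
    · rw [← X.norm_congr_ae hG hvm hbm.aemeasurable hvm.ae_eq_mk]
      exact hv.2
  · filter_upwards [hle, (quasiMeasurePreserving_of_map_le_smul hg hmap).ae hvm.ae_eq_mk]
      with y hy hy'
    rw [← hb] at hy'
    rw [← hy', ← enorm_norm (w y), ← enorm_norm (v (g y)), ← ofReal_norm, ← ofReal_norm,
      norm_norm, norm_norm, ← ENNReal.ofReal_coe_nnreal, ← ENNReal.ofReal_mul C.coe_nonneg]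
    exact ENNReal.ofReal_le_ofReal hy

/-! ### The derivative of the inverse map. -/

theorem LipschitzOnWith.norm_fderiv_le {E F : Type*} [NormedAddCommGroup E] [NormedSpace ℝ E]
    [NormedAddCommGroup F] [NormedSpace ℝ F] {f : E → F} {K : ℝ≥0} {s : Set E} (hs : IsOpen s)
    (hf : LipschitzOnWith K f s) {x : E} (hx : x ∈ s) : ‖fderiv ℝ f x‖ ≤ K :=
  norm_fderiv_le_of_lipschitzOn ℝ (hs.mem_nhds hx) hf

theorem LipschitzOnWith.ae_differentiableAt_of_isOpen {f : RSpace n → RSpace n} {K : ℝ≥0}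
    {s : Set (RSpace n)} (hs : IsOpen s) (hf : LipschitzOnWith K f s) :
    ∀ᵐ x ∂(volume.restrict s), DifferentiableAt ℝ f x := by
  filter_upwards [hf.ae_differentiableWithinAt hs.measurableSet, ae_restrict_mem hs.measurableSet]
    with x hx hxs using hx.differentiableAt (hs.mem_nhds hxs)

theorem OpenPartialHomeomorph.fderiv_mul_fderiv_symm
    (f : OpenPartialHomeomorph (RSpace n) (RSpace n)) {y : RSpace n} (hy : y ∈ f.target)
    (hf : DifferentiableAt ℝ f (f.symm y)) (hg : DifferentiableAt ℝ f.symm y) :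
    fderiv ℝ f (f.symm y) * fderiv ℝ f.symm y = 1 := by
  have h1 := (hf.hasFDerivAt.comp y hg.hasFDerivAt)
  have h2 : f ∘ f.symm =ᶠ[𝓝 y] id := f.eventually_right_inverse hy
  exact (h1.congr_of_eventuallyEq h2.symm).unique (hasFDerivAt_id y)

theorem locallyIntegrableOn_zero_fun {H : Type*} [NormedAddCommGroup H] (G : Set (RSpace n)) :
    LocallyIntegrableOn (0 : RSpace n → H) G volume :=
  locallyIntegrable_zero.locallyIntegrableOn _

theorem hasWeakDerivOn_zero {F : Type*} [NormedAddCommGroup F] [NormedSpace ℝ F]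
    (G : Set (RSpace n)) : HasWeakDerivOn G (0 : RSpace n → F) 0 :=
  ⟨locallyIntegrableOn_zero_fun G, locallyIntegrableOn_zero_fun G,
    fun φ _ _ _ w => by simp⟩

theorem ContDiff.exists_norm_fderiv_le {E F : Type*} [NormedAddCommGroup E] [NormedSpace ℝ E]
    [NormedAddCommGroup F] [NormedSpace ℝ F] {Φ : E → F} (hΦ : ContDiff ℝ 1 Φ)
    (hc : HasCompactSupport Φ) : ∃ M : ℝ≥0, ∀ x, ‖fderiv ℝ Φ x‖ ≤ M := by
  obtain ⟨C, hC⟩ := hΦ.lipschitzWith_of_hasCompactSupport hc one_ne_zero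
  exact ⟨C, fun x => norm_fderiv_le_of_lipschitz ℝ hC⟩

theorem LipschitzOnWith.memW1Loc_fderiv_symm [NeZero n] (X : RIBanachFunctionSpace n)
    (f : OpenPartialHomeomorph (RSpace n) (RSpace n)) {K : ℝ≥0}
    (hf : LipschitzOnWith K f f.source) (hf' : LipschitzOnWith K f.symm f.target)
    {Df : RSpace n → RSpace n →L[ℝ] RSpace n} (hDf : HasWeakDerivOn f.source f Df)
    (hW : MemW1Loc X f.source Df) : MemW1Loc X f.target (fderiv ℝ f.symm) := by
  intro G' hG'o hG'ne hG'c hG't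
  have hG't' : G' ⊆ f.target := subset_closure.trans hG't
  have hG' := IsFiniteDomain.of_isCompact_closure hG'o hG'ne hG'c
  set G := f.symm '' G' with hGdef
  have hGo : IsOpen G := f.symm.isOpen_image_of_subset_source hG'o hG't'
  have hcl : closure G ⊆ f.symm '' closure G' :=
    closure_minimal (image_mono subset_closure)
      (hG'c.image_of_continuousOn (f.continuousOn_symm.mono hG't)).isClosed
  have hGc : IsCompact (closure G) :=
    (hG'c.image_of_continuousOn (f.continuousOn_symm.mono hG't)).of_isClosed_subset
      isClosed_closure hcl
  have hGs : closure G ⊆ f.source := by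
    refine hcl.trans ?_
    rintro _ ⟨y, hy, rfl⟩
    exact f.map_target (hG't hy)
  have hGs' : G ⊆ f.source := subset_closure.trans hGs
  have hG := IsFiniteDomain.of_isCompact_closure hGo (hG'ne.image _) hGc
  obtain ⟨V, hV, -, hVX⟩ := hW G hGo (hG'ne.image _) hGc hGs
  -- The chain rule asks for a globally Lipschitz map. The extension may have a larger constant, but
  -- on the open target it agrees with `f.symm`, so the bound `K` for its derivative survives there.
  obtain ⟨g, hg, hgeq⟩ := hf'.extend_finite_dimension
  have hgm : Measurable g := hg.continuous.measurable
  have hgG : MapsTo g G' G := fun y hy => by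
    rw [← hgeq (hG't' hy)]
    exact mem_image_of_mem _ hy
  have hmap : Measure.map g (volume.restrict G') ≤ (K ^ n : ℝ≥0) • volume.restrict G :=
    map_restrict_le_of_lipschitzOnWith_leftInverse (hf.mono hGs') hgm hgG fun y hy => by
      rw [← hgeq (hG't' hy)]
      exact f.right_inv (hG't' hy)
  obtain ⟨Φ, hΦ, hΦc, hΦinv⟩ := exists_contDiff_hasCompactSupport_eq_inverse (n := n) (K : ℝ)
  obtain ⟨M, hM⟩ := hΦ.exists_norm_fderiv_le hΦc
  have hDfae : Df =ᵐ[volume.restrict G] fderiv ℝ f :=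
    ae_mono (Measure.restrict_mono hGs' le_rfl)
      (hDf.ae_eq f.open_source (hf.hasWeakDerivOn f.open_source))
  have hqmp := quasiMeasurePreserving_of_map_le_smul hgm hmap
  -- The exceptional sets of `f` live in `G`; by the pushforward bound their preimages under `g` are
  -- null in `G'`.
  have hΦeq : (fun y => Φ (Df (g y))) =ᵐ[volume.restrict G'] fderiv ℝ f.symm := by
    filter_upwards [hqmp.ae hDfae,
      hqmp.ae ((hf.mono hGs').ae_differentiableAt_of_isOpen hGo),
      (hf'.mono hG't').ae_differentiableAt_of_isOpen hG'o, ae_restrict_mem hG'o.measurableSet]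
      with y h1 h2 h3 hy
    have hyt := hG't' hy
    rw [h1]
    rw [← hgeq hyt] at h2 ⊢
    exact hΦinv _ _ (hf.norm_fderiv_le f.open_source (f.map_target hyt))
      (hf'.norm_fderiv_le f.open_target hyt) (f.fderiv_mul_fderiv_symm hyt h2 h3)
  have hchain := (hV.comp_contDiff_comp_lipschitz hGo hG'o hg hgG hmap hΦ hΦc).congr hΦeq
    (EventuallyEq.refl _ _)
  refine ⟨_, hchain, ?_, ?_⟩
  · refine RIBanachFunctionSpace.Mem.of_norm_le_const X hG' hchain.1.aestronglyMeasurable K ?_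
    filter_upwards [ae_restrict_mem hG'o.measurableSet] with y hy
    exact hf'.norm_fderiv_le f.open_target (hG't' hy)
  · refine RIBanachFunctionSpace.Mem.of_norm_le_const_mul_comp X hG hG' hgm hmap hVX
      hchain.2.aestronglyMeasurable (M * K) ?_
    filter_upwards [ae_restrict_mem hG'o.measurableSet] with y hy
    have hgy : ‖fderiv ℝ g y‖ ≤ K := by
      refine LipschitzOnWith.norm_fderiv_le f.open_target ?_ (hG't' hy)
      intro x hx x' hx'
      rw [← hgeq hx, ← hgeq hx']
      exact hf' hx hx'
    calc _ ≤ ‖fderiv ℝ Φ (Df (g y))‖ * (‖V (g y)‖ * ‖fderiv ℝ g y‖) :=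
          (ContinuousLinearMap.opNorm_comp_le _ _).trans (by
            gcongr; exact ContinuousLinearMap.opNorm_comp_le _ _)
      _ ≤ M * (‖V (g y)‖ * K) := by
          gcongr
          exact hM _
      _ = _ := by push_cast; ring

end RearrangementInvariant

theorem mainTheorem6 (n : ℕ) (X : RIBanachFunctionSpace n) (Ω Ω' : Set (RSpace n))
    (hΩ : IsOpen Ω) (hΩ' : IsOpen Ω')
    (f : OpenPartialHomeomorph (RSpace n) (RSpace n))
    (hsource : f.source = Ω) (htarget : f.target = Ω')
    (hf : IsBilipschitzOn f Ω)
    (Df : RSpace n → RSpace n →L[ℝ] RSpace n)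
    (hDf : HasWeakDerivOn Ω f Df)
    (hW : MemW1Loc X Ω Df) :
    ∃ Dg : RSpace n → RSpace n →L[ℝ] RSpace n,
      HasWeakDerivOn Ω' f.symm Dg ∧ MemW1Loc X Ω' Dg := by
  -- In dimension zero a point is an atom and halving fails, but there every map is constant and the
  -- zero derivative works.
  rcases eq_or_ne n 0 with rfl | hn
  · refine ⟨0, ?_, fun G hG hne hc _ => ⟨0, hasWeakDerivOn_zero G, ?_, ?_⟩⟩
    · rw [show (f.symm : RSpace 0 → RSpace 0) = 0 from Subsingleton.elim _ _]
      exact hasWeakDerivOn_zero Ω'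
    all_goals
      refine RIBanachFunctionSpace.Mem.of_norm_le_const X
        (IsFiniteDomain.of_isCompact_closure hG hne hc) aestronglyMeasurable_zero 0 ?_
      exact Eventually.of_forall fun x => by simp
  have : NeZero n := ⟨hn⟩
  subst hsource htarget
  obtain ⟨L, hL, hfL⟩ := hf
  have h1 : LipschitzOnWith ⟨L, hL.le⟩ f f.source := by
    refine LipschitzOnWith.of_dist_le_mul fun x hx y hy => ?_
    rw [dist_eq_norm, dist_eq_norm]
    exact (hfL x hx y hy).2
  have h2 : LipschitzOnWith ⟨L, hL.le⟩ f.symm f.target := by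
    refine LipschitzOnWith.of_dist_le_mul fun x hx y hy => ?_
    have := (hfL _ (f.map_target hx) _ (f.map_target hy)).1
    rw [f.right_inv hx, f.right_inv hy, inv_mul_le_iff₀ hL] at this
    rw [dist_eq_norm, dist_eq_norm]
    exact this
  exact ⟨fderiv ℝ f.symm, h2.hasWeakDerivOn f.open_target,
    LipschitzOnWith.memW1Loc_fderiv_symm X f h1 h2 hDf hW⟩
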